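/- **Setting.** Let $S=\Sigma^*=(\sigma_{ij})$ be a positive definite $p\times p$ correlation matrix ($\sigma_{jj}=1$) and let $\Theta^*=(\theta^*_{ij})=(\Sigma^*)^{-1}$. Let $x_1,\dots,x_n$ ($n\ge 1$) be i.i.d. random vectors in $\mathbb R^p$ from the nonparanormal model: there are univariate monotone increasing transformations $f_1,\dots,f_p$ (each $f_j$ being increasing on a set that contains the $j$-th coordinate almost surely) with $(f_1(X_1),\dots,f_p(X_p))\sim N_p(0,\Sigma^*)$. Let $\hat r_{ij}$ be Spearman's rank correlation of variables $i$ and $j$ (the Pearson correlation of their ranks) and $\hat R^s=\bigl(2\sin(\tfrac{\pi}{6}\hat r_{ij})\bigr)_{i,j}$. The rank-based CLIME $\hat\Theta^s_c$ with parameter $\lambda_c$ is an optimal solution of $$\min_\Theta \sum_{i,j}|\theta_{ij}|\quad\text{subject to}\quad \max_{i,j}|(\hat R^s\Theta-I)_{ij}|\le\lambda_c .$$ With the weights $W=(w_{ij})$, $w_{ij}=(|\hat\theta^{s.c}_{ij}|+1/n)^{-1}$, the rank-based adaptive CLIME $\hat\Theta^s_{ac}$ with parameter $\lambda_{ac}$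 is an optimal solution of $$\min_\Theta \sum_{i,j}w_{ij}|\theta_{ij}|\quad\text{subject to}\quad |(\hat R^s\Theta-I)_{ij}|\le\lambda_{ac}w_{ij}\ \text{ for all } i,j .$$ For a matrix $A$ let $\|A\|_{\ell_1}$ be its maximal absolute column sum and $\|A\|_{\ell_\infty}$ its maximal absolute row sum ($0$ if there are no rows), and let $\lambda_{\min}$ denote the smallest eigenvalue. Let $\mathcal A=\{(i,j): i\ne j,\ \theta^*_{ij}\neq0\}$, which is assumed to be nonempty, $\psi_{\min}=\min_{(i,j)\in\mathcal A}|\theta^*_{ij}|$, $M=\|\Theta^*\|_{\ell_1}$, $\mathcal A_k=\{j\ne k:\theta^*_{kj}\ne0\}$, $\tilde{\mathcal A}_k=\mathcal A_k\cup\{k\}$, $d=\max_k|\mathcal A_k|$, $\tilde G_k=\|(\Sigma^*_{\tilde{\mathcal A}_k\tilde{\mathcal A}_k})^{-1}\|_{\ell_\infty}$, and $\tilde H_k=\|\Sigma^*_{\tilde{\mathcal A}_k^c\tilde{\mathcal A}_k}(\Sigma^*_{\tilde{\mathcal A}_k\tilde{\mathcal A}_k})^{-1}\|_{\ell_\infty}$,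 where $\tilde{\mathcal A}_k^c=\{1,\dots,p\}\setminus\tilde{\mathcal A}_k$. **Theorem 5.** There is an absolute constant $c_0>0$ such that the following holds in the setting above, for all $n$, $p$, $\Sigma^*$ and all distributions of the model. Suppose that for every $k=1,\dots,p$ $$\frac{12\pi M}{n}\le\lambda_c\le\min\Bigl\{\frac{\psi_{\min}}{4M},\ \frac{1}{4M(\psi_{\min}+2\tilde G_k)d}-\frac{2}{Mn}\Bigr\},$$ $$\max\Bigl\{\frac{12\pi}{n},\ \bigl(2M\lambda_c+\tfrac1n\bigr)\frac{\tilde H_k\psi_{\min}}{\tilde G_k}\Bigr\}\le\lambda_{ac}\le\frac{\psi_{\min}^2}{8\tilde G_k},$$ $$d\lambda_{ac}\le\min\Bigl\{\lambda_{\min}(\Sigma^*_{\mathcal A_k\mathcal A_k}),\ \frac{1}{2\tilde G_k},\ \frac{\psi_{\min}}{4\tilde G_k(\psi_{\min}+\tilde G_k)}\Bigr\},$$ where the term $\lambda_{\min}(\Sigma^*_{\mathcal A_k\mathcal A_k})$ is omitted if $\mathcal A_k=\emptyset$. Then with probability at least $$1-p^2\exp\Bigl(-c_0\,n\min\bigl\{\lambda_{ac}^2,\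 \tfrac{1}{M^2}\lambda_c^2\bigr\}\Bigr)$$ both optimization problems have optimal solutions and, whatever optimal solution $\hat\Theta^s_c$ is used in the weights, every optimal solution $\hat\Theta^s_{ac}$ of the adaptive problem is sign consistent: $\operatorname{sign}(\hat\theta^{s.ac}_{ij})=\operatorname{sign}(\theta^*_{ij})$ for all $(i,j)\in\mathcal A$, and $\hat\theta^{s.ac}_{ij}=0$ for all $i\ne j$ with $(i,j)\notin\mathcal A$. -/

import Mathlib

open MeasureTheory ProbabilityTheory

noncomputable section

namespace RankClime

/-! ### The nonparanormal model -/

/-- The law `P` on `ℝ^p` is nonparanormal with covariance `S`: there are univariate monotone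
increasing transformations `f_j` such that `(f_1(X_1), …, f_p(X_p)) ∼ N_p(0, S)` for `X ∼ P`.
Each `f_j` has to be increasing only on a set `D j` which contains the `j`-th coordinate almost
surely, so that `f_j = Φ⁻¹ ∘ F_j` is allowed also when the range of `X_j` is not all of `ℝ`. -/
def IsNonparanormal {p : ℕ} (P : Measure (Fin p → ℝ)) (S : Matrix (Fin p) (Fin p) ℝ) : Prop :=
  ∃ (f : Fin p → ℝ → ℝ) (D : Fin p → Set ℝ),
    (∀ j, Measurable (f j)) ∧ (∀ j, MonotoneOn (f j) (D j)) ∧ (∀ j, ∀ᵐ x ∂P, x j ∈ D j) ∧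
      HasLaw (fun x : Fin p → ℝ => WithLp.toLp 2 (fun j => f j (x j)))
        (multivariateGaussian (0 : EuclideanSpace ℝ (Fin p)) S) P

/-! ### The rank-based estimate of the correlation matrix -/

open Classical in
/-- Rank of the `t`-th entry of `v` (average rank in case of ties): the number of entries that are
strictly smaller, plus the mean of `1, …, m`, where `m` is the number of entries equal to `v t`.
Without ties it is the position of `v t` in increasing order, counted from `1`. -/
def rank {n : ℕ} (v : Fin n → ℝ) (t : Fin n) : ℝ :=
  ((Finset.univ.filter fun s => v s < v t).card : ℝ) +
    (((Finset.univ.filter fun s => v s = v t).card : ℝ) + 1) / 2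

/-- The sample mean. -/
def mean {n : ℕ} (a : Fin n → ℝ) : ℝ := (∑ t, a t) / n

/-- Pearson's sample correlation. -/
def pearson {n : ℕ} (a b : Fin n → ℝ) : ℝ :=
  (∑ t, (a t - mean a) * (b t - mean b)) /
    (Real.sqrt (∑ t, (a t - mean a) ^ 2) * Real.sqrt (∑ t, (b t - mean b) ^ 2))

/-- Spearman's rank correlation: Pearson's correlation of the ranks. -/
def spearman {n : ℕ} (a b : Fin n → ℝ) : ℝ := pearson (rank a) (rank b)

/-- The matrix of adjusted Spearman correlations `2 sin (π/6 · r̂_ij)`; the data are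
`x t j`, the value of variable `j` in sample `t`. -/
def rankCorr {n p : ℕ} (x : Fin n → Fin p → ℝ) : Matrix (Fin p) (Fin p) ℝ :=
  Matrix.of fun i j =>
    2 * Real.sin (Real.pi / 6 * spearman (fun t => x t i) (fun t => x t j))

/-! ### The rank-based CLIME and the rank-based adaptive CLIME -/

/-- Entrywise `ℓ₁` norm of a matrix. -/
def entryL1 {p : ℕ} (A : Matrix (Fin p) (Fin p) ℝ) : ℝ := ∑ i, ∑ j, |A i j|

/-- `T` is an optimal solution of the CLIME problem: minimize `‖Θ‖₁` subject to
`‖R Θ - I‖_max ≤ lam`. -/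
def IsClime {p : ℕ} (R : Matrix (Fin p) (Fin p) ℝ) (lam : ℝ)
    (T : Matrix (Fin p) (Fin p) ℝ) : Prop :=
  T ∈ {U : Matrix (Fin p) (Fin p) ℝ | ∀ i j, |(R * U - 1) i j| ≤ lam} ∧
    IsMinOn entryL1 {U : Matrix (Fin p) (Fin p) ℝ | ∀ i j, |(R * U - 1) i j| ≤ lam} T

/-- `T` is an optimal solution of the adaptive CLIME problem with weights `W`: minimize
`‖W ∘ Θ‖₁` (Hadamard product) subject to `|R Θ - I| ≤ lam W` entrywise. -/
def IsAdaptiveClime {p : ℕ} (R W : Matrix (Fin p) (Fin p) ℝ) (lam : ℝ)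
    (T : Matrix (Fin p) (Fin p) ℝ) : Prop :=
  T ∈ {U : Matrix (Fin p) (Fin p) ℝ | ∀ i j, |(R * U - 1) i j| ≤ lam * W i j} ∧
    IsMinOn (fun U => entryL1 (Matrix.hadamard W U))
      {U : Matrix (Fin p) (Fin p) ℝ | ∀ i j, |(R * U - 1) i j| ≤ lam * W i j} T

/-- The adaptive weights `(|Θ| + 1/n)⁻¹`, entrywise. -/
def adaptiveWeights {p : ℕ} (n : ℕ) (T : Matrix (Fin p) (Fin p) ℝ) :
    Matrix (Fin p) (Fin p) ℝ :=
  Matrix.of fun i j => (|T i j| + 1 / (n : ℝ))⁻¹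

/-! ### Population quantities -/

/-- Matrix `ℓ₁` norm: maximal absolute column sum. -/
def matL1 {κ μ : Type*} [Fintype κ] [Fintype μ] (A : Matrix κ μ ℝ) : ℝ := ⨆ j, ∑ i, |A i j|

/-- Matrix `ℓ_∞` norm: maximal absolute row sum (`0` if there are no rows). -/
def matLinf {κ μ : Type*} [Fintype κ] [Fintype μ] (A : Matrix κ μ ℝ) : ℝ := ⨆ i, ∑ j, |A i j|

/-- Smallest eigenvalue of a symmetric matrix (of positive size). -/
def lambdaMin {κ : Type*} [Fintype κ] [DecidableEq κ] (A : Matrix κ κ ℝ) : ℝ :=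
  sInf (spectrum ℝ A)

/-- The submatrix with row indices in `T` and column indices in `U`. -/
def subMat {p : ℕ} (A : Matrix (Fin p) (Fin p) ℝ) (T U : Finset (Fin p)) : Matrix T U ℝ :=
  A.submatrix Subtype.val Subtype.val

/-- The support of the off-diagonal entries of `Th`. -/
def support {p : ℕ} (Th : Matrix (Fin p) (Fin p) ℝ) : Set (Fin p × Fin p) :=
  {q | q.1 ≠ q.2 ∧ Th q.1 q.2 ≠ 0}

/-- The minimal absolute value of the entries of `Th` over its off-diagonal support. -/
def psiMin {p : ℕ} (Th : Matrix (Fin p) (Fin p) ℝ) : ℝ :=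
  sInf ((fun q : Fin p × Fin p => |Th q.1 q.2|) '' support Th)

open Classical in
/-- The active set `{j ≠ k : Th k j ≠ 0}` of variable `k`. -/
def active {p : ℕ} (Th : Matrix (Fin p) (Fin p) ℝ) (k : Fin p) : Finset (Fin p) :=
  Finset.univ.filter fun j => j ≠ k ∧ Th k j ≠ 0

/-- The active set of `k` together with `k` itself. -/
def activeT {p : ℕ} (Th : Matrix (Fin p) (Fin p) ℝ) (k : Fin p) : Finset (Fin p) :=
  insert k (active Th k)

/-- The maximal degree `d = max_k |active k|`. -/
def maxDeg {p : ℕ} (Th : Matrix (Fin p) (Fin p) ℝ) : ℕ :=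
  Finset.univ.sup fun k => (active Th k).card

/-- `G̃_k = ‖(Σ_{ÃÃ})⁻¹‖_{ℓ_∞}`, where `Ã` is the active set of `k` for `Σ⁻¹` together with `k`. -/
def Gt {p : ℕ} (S : Matrix (Fin p) (Fin p) ℝ) (k : Fin p) : ℝ :=
  matLinf (subMat S (activeT S⁻¹ k) (activeT S⁻¹ k))⁻¹

/-- `H̃_k = ‖Σ_{Ãᶜ Ã} (Σ_{ÃÃ})⁻¹‖_{ℓ_∞}`. -/
def Ht {p : ℕ} (S : Matrix (Fin p) (Fin p) ℝ) (k : Fin p) : ℝ :=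
  matLinf (subMat S (activeT S⁻¹ k)ᶜ (activeT S⁻¹ k) *
    (subMat S (activeT S⁻¹ k) (activeT S⁻¹ k))⁻¹)

/-- `T` is sign consistent for `Th`: the signs agree on the off-diagonal support of `Th`, and the
off-diagonal entries of `T` off that support vanish. -/
def SignConsistent {p : ℕ} (Th T : Matrix (Fin p) (Fin p) ℝ) : Prop :=
  ∀ i j, i ≠ j →
    (Th i j ≠ 0 → SignType.sign (T i j) = SignType.sign (Th i j)) ∧
      (Th i j = 0 → T i j = 0)

/-- For the sample correlation matrix `R` and sample size `n`: the CLIME problem with parameter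
`lamC` has an optimal solution, and for every optimal solution `U` of it, the adaptive CLIME
problem with weights `(|U| + 1/n)⁻¹` and parameter `lamAC` has an optimal solution, and all its
optimal solutions are sign consistent for `Th`. -/
def AdaptiveClimeConsistent {p : ℕ} (n : ℕ) (R Th : Matrix (Fin p) (Fin p) ℝ)
    (lamC lamAC : ℝ) : Prop :=
  (∃ U, IsClime R lamC U) ∧
    ∀ U, IsClime R lamC U →
      (∃ T, IsAdaptiveClime R (adaptiveWeights n U) lamAC T) ∧
        ∀ T, IsAdaptiveClime R (adaptiveWeights n U) lamAC T → SignConsistent Th T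

end RankClime

end

/-! The argument splits into a deterministic statement about any symmetric matrix `R` with unit
diagonal close to `S` in the maximum norm, and a concentration bound showing that the rank-based
matrix is such an `R`.

Deterministic part (`adaptiveClimeConsistent_of_close`). Since `S⁻¹` is feasible for CLIME and the
problem separates into columns, the CLIME has column sums at most `M`, and this gives a maximum-norm
error of at most `2 M lamC` (`IsClime.abs_sub_le`). So the weights are at most `2 / ψ` on active
entries, at most `4 / 3` on the diagonal, and at least `1 / (2 M lamC + 1 / n)` elsewhere. The
adaptive problem separates into columns as well. Fix a column `k`, let `T` be its active set
together with `k`, and for `i ∉ T` write row `i` of `R`, restricted to the columns in `T`, as a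
combination of the rows in `T` with coefficients `c i`. If these are small compared with the weight
of `i`, then moving the mass `θ i` onto `T` along `c i` leaves the constraints on `T` untouched,
makes the objective strictly smaller, and the constraints off `T` follow from those on `T`. Hence
every optimum lives on `T` (`support_of_optimal`). Definiteness of `R` plays no role, only
invertibility of its `T`-block, which follows by perturbation from `S` (`IsPerturbation`). The
smallness of `c i` is `exists_coefficients`; the decisive fact is that its population analogue
vanishes at `k`, because `S * S⁻¹ = 1`. On `T` the optimum solves nearly the same linear system as
the true column, so it errs by less than `ψ` and has the right signs (`abs_sub_inv_lt`).

Probabilistic part (`exists_bad_event`). Ranks are affine in sums of signs of differences, so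
Spearman's correlation is, up to `O(1/n)`, three times a U-statistic of degree three. Signs are
invariant under the monotone transformations, so Gaussian data may be used; the mean is then `(2 /
π) arcsin (S i j / 2)`, which `2 sin (π / 6 · 3 ·)` turns back into `S i j`. Hoeffding's averaging
over permutations (`hasSubgaussianMGF_uStatistic`) and a union bound over pairs finish the proof. -/

noncomputable section

namespace RankClime

/-! ### Hoeffding's inequality for U-statistics of degree three -/

section UStatistic

variable {Ω : Type*} {mΩ : MeasurableSpace Ω} {μ : Measure Ω}

/-- Without independence it is the square roots of the parameters that add up, whence the squared
cardinality. -/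
lemma hasSubgaussianMGF_sum [IsProbabilityMeasure μ] {ι : Type*} (s : Finset ι) {X : ι → Ω → ℝ}
    {c : NNReal} (h : ∀ i ∈ s, HasSubgaussianMGF (X i) c μ) :
    HasSubgaussianMGF (fun ω => ∑ i ∈ s, X i ω) ((s.card : NNReal) ^ 2 * c) μ := by
  classical
  induction s using Finset.induction with
  | empty => simp
  | insert a s ha ih =>
    simp only [Finset.sum_insert ha]
    have h1 := (h a (Finset.mem_insert_self a s)).add
      (ih fun i hi => h i (Finset.mem_insert_of_mem hi))
    convert h1 using 1
    rw [NNReal.sqrt_mul, NNReal.sqrt_sq, Finset.card_insert_of_notMem ha]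
    push_cast
    conv_lhs => rw [← NNReal.sq_sqrt c]
    ring

lemma hasSubgaussianMGF_const_mul {X : Ω → ℝ} {c c' : NNReal} (h : HasSubgaussianMGF X c μ) (r : ℝ)
    (hc : (c' : ℝ) = r ^ 2 * c) : HasSubgaussianMGF (fun ω => r * X ω) c' μ := by
  have h1 := h.const_mul r
  convert h1 using 1
  exact NNReal.eq hc

/-- Averaging arbitrarily dependent variables costs nothing: the factor `card ^ 2` cancels. This is
what allows averaging over all permutations. -/
lemma hasSubgaussianMGF_average [IsProbabilityMeasure μ] {ι : Type*} [Fintype ι] [Nonempty ι]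
    {X : ι → Ω → ℝ} {c : NNReal} (h : ∀ i, HasSubgaussianMGF (X i) c μ) :
    HasSubgaussianMGF (fun ω => (Fintype.card ι : ℝ)⁻¹ * ∑ i, X i ω) c μ := by
  have h0 : (Fintype.card ι : ℝ) ≠ 0 := by exact_mod_cast Fintype.card_ne_zero
  refine hasSubgaussianMGF_const_mul (hasSubgaussianMGF_sum Finset.univ fun i _ => h i) _ ?_
  simp only [NNReal.coe_mul, NNReal.coe_pow, NNReal.coe_natCast, Finset.card_univ]
  field_simp

/-- Functions of disjoint blocks of independent variables are independent, so here the parameters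
themselves add up and the cardinality enters only linearly. -/
lemma hasSubgaussianMGF_sum_of_disjoint [IsProbabilityMeasure μ] {E : Type*} [MeasurableSpace E]
    {ι κ : Type*} [DecidableEq ι]
    {Z : ι → Ω → E} (hZ : iIndepFun Z μ) (hm : ∀ i, AEMeasurable (Z i) μ)
    {T : κ → Finset ι} {φ : ∀ b, (T b → E) → ℝ} (hφ : ∀ b, Measurable (φ b)) {c : NNReal}
    (s : Finset κ) (hd : (s : Set κ).PairwiseDisjoint T)
    (h : ∀ b ∈ s, HasSubgaussianMGF (fun ω => φ b fun i => Z i ω) c μ) :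
    HasSubgaussianMGF (fun ω => ∑ b ∈ s, φ b fun i => Z i ω) (s.card * c) μ := by
  classical
  induction s using Finset.induction with
  | empty => simp
  | insert a s ha ih =>
    simp only [Finset.sum_insert ha]
    have hd' : (s : Set κ).PairwiseDisjoint T := hd.subset (by simp)
    have hdis : Disjoint (T a) (s.biUnion T) := by
      rw [Finset.disjoint_biUnion_right]
      intro b hb
      exact hd (by simp) (by simp [hb]) fun hab => ha (hab ▸ hb)
    have hind := hZ.indepFun_finset₀ (T a) (s.biUnion T) hdis hm
    let ψ : (s.biUnion T → E) → ℝ := fun x => ∑ b ∈ s.attach,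
      φ b.1 fun i => x ⟨i, Finset.mem_biUnion.2 ⟨b, b.2, i.2⟩⟩
    have hψ : Measurable ψ := Finset.measurable_sum _ fun b _ =>
      (hφ b.1).comp (measurable_pi_lambda _ fun i => measurable_pi_apply _)
    have hind2 := hind.comp (hφ a) hψ
    have e : ψ ∘ (fun ω (i : s.biUnion T) => Z i ω) = fun ω => ∑ b ∈ s, φ b fun i => Z i ω := by
      funext ω
      exact Finset.sum_attach s fun b => φ b fun i => Z i ω
    rw [e] at hind2
    have := (h a (by simp)).add_of_indepFun
      (ih hd' fun b hb => h b (Finset.mem_insert_of_mem hb)) hind2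
    convert this using 1
    rw [Finset.card_insert_of_notMem ha]
    push_cast
    ring

/-- The triples of pairwise distinct indices. -/
def distinctTriples (n : ℕ) : Finset (Fin n × Fin n × Fin n) :=
  Finset.univ.filter fun q => q.1 ≠ q.2.1 ∧ q.1 ≠ q.2.2 ∧ q.2.1 ≠ q.2.2

lemma mem_distinctTriples {n : ℕ} {q : Fin n × Fin n × Fin n} :
    q ∈ distinctTriples n ↔ q.1 ≠ q.2.1 ∧ q.1 ≠ q.2.2 ∧ q.2.1 ≠ q.2.2 := by
  simp [distinctTriples]

/-- The action of a permutation on triples. -/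
def permTriple {n : ℕ} (σ : Equiv.Perm (Fin n)) :
    Fin n × Fin n × Fin n ≃ Fin n × Fin n × Fin n :=
  σ.prodCongr (σ.prodCongr σ)

lemma injective_vec_three {α : Type*} {a b c : α} (h1 : a ≠ b) (h2 : a ≠ c) (h3 : b ≠ c) :
    Function.Injective ![a, b, c] := by
  intro i j hij
  fin_cases i <;> fin_cases j <;> simp_all

/-- The symmetric group acts transitively on triples of distinct indices; right multiplication by a
permutation carrying `q'` to `q` reindexes one sum into the other. -/
lemma sum_perm_triple_eq {n : ℕ} (F : Fin n × Fin n × Fin n → ℝ)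
    {q q' : Fin n × Fin n × Fin n}
    (hq : q ∈ distinctTriples n) (hq' : q' ∈ distinctTriples n) :
    ∑ σ : Equiv.Perm (Fin n), F (permTriple σ q) =
      ∑ σ : Equiv.Perm (Fin n), F (permTriple σ q') := by
  obtain ⟨a, b, c⟩ := q
  obtain ⟨a', b', c'⟩ := q'
  rw [mem_distinctTriples] at hq hq'
  obtain ⟨h1, h2, h3⟩ := hq
  obtain ⟨k1, k2, k3⟩ := hq'
  simp only at h1 h2 h3 k1 k2 k3
  obtain ⟨τ, hτ⟩ := Equiv.Perm.exists_extending_pair _ _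
    (injective_vec_three k1 k2 k3) (injective_vec_three h1 h2 h3)
  have t0 : τ a' = a := by simpa using hτ 0
  have t1 : τ b' = b := by simpa using hτ 1
  have t2 : τ c' = c := by simpa using hτ 2
  rw [← Equiv.sum_comp (Equiv.mulRight τ) fun σ => F (permTriple σ (a', b', c'))]
  refine Finset.sum_congr rfl fun σ _ => ?_
  simp only [permTriple, Equiv.prodCongr_apply, Prod.map, Equiv.coe_mulRight, Equiv.Perm.mul_apply,
    t0, t1, t2]

lemma card_mul_sum_perm {n : ℕ} (F : Fin n × Fin n × Fin n → ℝ)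
    {q : Fin n × Fin n × Fin n} (hq : q ∈ distinctTriples n) :
    ((distinctTriples n).card : ℝ) * ∑ σ : Equiv.Perm (Fin n), F (permTriple σ q) =
      (Fintype.card (Equiv.Perm (Fin n)) : ℝ) * ∑ q ∈ distinctTriples n, F q := by
  have h1 : ∑ q' ∈ distinctTriples n, ∑ σ : Equiv.Perm (Fin n), F (permTriple σ q') =
      ((distinctTriples n).card : ℝ) * ∑ σ : Equiv.Perm (Fin n), F (permTriple σ q) := by
    rw [Finset.sum_congr rfl fun q' hq' => sum_perm_triple_eq F hq' hq, Finset.sum_const,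
      nsmul_eq_mul]
  rw [← h1, Finset.sum_comm]
  have h2 : ∀ σ : Equiv.Perm (Fin n), ∑ q' ∈ distinctTriples n, F (permTriple σ q') =
      ∑ q ∈ distinctTriples n, F q := by
    intro σ
    refine Finset.sum_equiv (permTriple σ) ?_ fun _ _ => rfl
    intro q
    simp [mem_distinctTriples, permTriple]
  rw [Finset.sum_congr rfl fun σ _ => h2 σ, Finset.sum_const, nsmul_eq_mul, Finset.card_univ]

/-- The U-statistic of the kernel `h`, centred at its mean `θ`, is sub-Gaussian. -/
lemma hasSubgaussianMGF_uStatistic [IsProbabilityMeasure μ] {E : Type*} [MeasurableSpace E]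
    {n m : ℕ} (hm0 : 0 < m) (hmn : 3 * m ≤ n) {Z : Fin n → Ω → E} (hZ : iIndepFun Z μ)
    (hm : ∀ i, AEMeasurable (Z i) μ) {h : E × E × E → ℝ} (hh : Measurable h)
    (hb : ∀ x, |h x| ≤ 1) {θ : ℝ}
    (hθ : ∀ q ∈ distinctTriples n, ∫ ω, h (Z q.1 ω, Z q.2.1 ω, Z q.2.2 ω) ∂μ = θ) :
    HasSubgaussianMGF (fun ω => (∑ q ∈ distinctTriples n, h (Z q.1 ω, Z q.2.1 ω, Z q.2.2 ω)) /
      ((distinctTriples n).card : ℝ) - θ) (m : NNReal)⁻¹ μ := by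
  classical
  -- Hoeffding's device: `m` consecutive disjoint triples give an average of independent terms, and
  -- averaging this over all relabelings of the sample recovers the U-statistic.
  let q : Fin m → Fin n × Fin n × Fin n := fun b =>
    (⟨3 * b, by omega⟩, ⟨3 * b + 1, by omega⟩, ⟨3 * b + 2, by omega⟩)
  have hq : ∀ b, q b ∈ distinctTriples n := by
    intro b
    simp [mem_distinctTriples, q]
  let hc : Fin n × Fin n × Fin n → Ω → ℝ := fun q ω => h (Z q.1 ω, Z q.2.1 ω, Z q.2.2 ω)
  have hsub : ∀ q ∈ distinctTriples n, HasSubgaussianMGF (fun ω => hc q ω - θ) 1 μ := by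
    intro q hq
    have h1 := hasSubgaussianMGF_of_mem_Icc (μ := μ) (X := hc q) (a := -1) (b := 1)
      (hh.comp_aemeasurable ((hm _).prodMk ((hm _).prodMk (hm _))))
      (ae_of_all _ fun ω => abs_le.1 (hb _))
    rw [show (∫ ω, hc q ω ∂μ) = θ from hθ q hq] at h1
    convert h1 using 1
    ext
    norm_num
  have hperm : ∀ (σ : Equiv.Perm (Fin n)), ∀ q ∈ distinctTriples n,
      permTriple σ q ∈ distinctTriples n := by
    intro σ q hq
    simpa [mem_distinctTriples, permTriple] using hq
  have hblock : ∀ σ : Equiv.Perm (Fin n), HasSubgaussianMGF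
      (fun ω => (m : ℝ)⁻¹ * ∑ b : Fin m, (hc (permTriple σ (q b)) ω - θ)) (m : NNReal)⁻¹ μ := by
    intro σ
    have h1 := hasSubgaussianMGF_sum_of_disjoint hZ hm
      (T := fun b : Fin m => {σ (q b).1, σ (q b).2.1, σ (q b).2.2})
      (φ := fun b x => h (x ⟨σ (q b).1, by simp⟩, x ⟨σ (q b).2.1, by simp⟩,
        x ⟨σ (q b).2.2, by simp⟩) - θ) (fun b => by fun_prop) (c := 1) Finset.univ ?_ ?_
    · have h0 : (m : ℝ) ≠ 0 := by exact_mod_cast hm0.ne'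
      refine hasSubgaussianMGF_const_mul h1 _ ?_
      simp only [NNReal.coe_mul, NNReal.coe_natCast, Finset.card_univ,
        NNReal.coe_inv, Fintype.card_fin, NNReal.coe_one]
      field_simp
    · intro b _ b' _ hbb
      have hv : (b : ℕ) ≠ b' := fun h => hbb (Fin.ext h)
      simp only [Function.onFun, q, Finset.disjoint_left, Finset.mem_insert, Finset.mem_singleton]
      rintro x (rfl | rfl | rfl) <;> simp [Fin.ext_iff] <;> omega
    · intro b _
      exact hsub _ (hperm σ _ (hq b))
  have havg := hasSubgaussianMGF_average hblock
  convert havg using 1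
  funext ω
  have hN : ((distinctTriples n).card : ℝ) ≠ 0 := by
    exact_mod_cast (Finset.card_pos.2 ⟨q ⟨0, hm0⟩, hq _⟩).ne'
  have hP : (Fintype.card (Equiv.Perm (Fin n)) : ℝ) ≠ 0 := by exact_mod_cast Fintype.card_ne_zero
  have h0 : (m : ℝ) ≠ 0 := by exact_mod_cast hm0.ne'
  rw [← Finset.mul_sum, Finset.sum_comm]
  -- For each single block, the sum over permutations already is a multiple of the centred
  -- U-statistic, by `card_mul_sum_perm`.
  have hs : ∀ b : Fin m, ∑ σ : Equiv.Perm (Fin n), (hc (permTriple σ (q b)) ω - θ) =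
      (Fintype.card (Equiv.Perm (Fin n)) : ℝ) *
        ((∑ q ∈ distinctTriples n, hc q ω) / ((distinctTriples n).card : ℝ) - θ) := by
    intro b
    rw [Finset.sum_sub_distrib, Finset.sum_const, nsmul_eq_mul, Finset.card_univ, mul_sub,
      mul_div_assoc', ← card_mul_sum_perm (fun q => hc q ω) (hq b)]
    field_simp
  rw [Finset.sum_congr rfl fun b _ => hs b, Finset.sum_const, Finset.card_univ, Fintype.card_fin,
    nsmul_eq_mul]
  field_simp
  rfl

end UStatistic

/-! ### Expected products of signs of Gaussian variables -/

section GaussianSigns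

open Real

lemma measurable_sign : Measurable Real.sign := by
  unfold Real.sign
  exact Measurable.ite measurableSet_Iio measurable_const
    (Measurable.ite measurableSet_Ioi measurable_const measurable_const)

lemma abs_sign_le_one (x : ℝ) : |Real.sign x| ≤ 1 := by
  rcases Real.sign_apply_eq x with h | h | h <;> simp [h]

lemma sign_pos_mul {r : ℝ} (hr : 0 < r) (x : ℝ) : Real.sign (r * x) = Real.sign x := by
  rcases lt_trichotomy x 0 with h | rfl | h
  · rw [Real.sign_of_neg h, Real.sign_of_neg (mul_neg_of_pos_of_neg hr h)]
  · simp
  · rw [Real.sign_of_pos h, Real.sign_of_pos (mul_pos hr h)]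

lemma integral_gaussian_prod (F : ℝ × ℝ → ℝ) :
    ∫ x, F x ∂((gaussianReal 0 1).prod (gaussianReal 0 1)) =
      ∫ x : ℝ × ℝ, (2 * π)⁻¹ * rexp (-(x.1 ^ 2 + x.2 ^ 2) / 2) * F x := by
  rw [gaussianReal_of_var_ne_zero _ one_ne_zero,
    prod_withDensity (measurable_gaussianPDF _ _) (measurable_gaussianPDF _ _),
    integral_withDensity_eq_integral_toReal_smul₀ (by fun_prop)
      (ae_of_all _ fun x => ENNReal.mul_lt_top gaussianPDF_lt_top gaussianPDF_lt_top)]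
  rw [← Measure.volume_eq_prod]
  refine integral_congr_ae (ae_of_all _ fun x => ?_)
  simp only [ENNReal.toReal_mul, toReal_gaussianPDF, gaussianPDFReal, smul_eq_mul, sub_zero,
    NNReal.coe_one, mul_one]
  rw [show -(x.1 ^ 2 + x.2 ^ 2) / 2 = -x.1 ^ 2 / 2 + -x.2 ^ 2 / 2 by ring, Real.exp_add]
  have h : (√(2 * π))⁻¹ * (√(2 * π))⁻¹ = (2 * π)⁻¹ := by
    rw [← mul_inv, Real.mul_self_sqrt (by positivity)]
  rw [← h]
  ring

/-- In polar coordinates the standard Gaussian density depends on the radius only, so an integrand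
depending on the angle only splits off. -/
lemma integral_gaussian_prod_polar {F : ℝ × ℝ → ℝ} {g : ℝ → ℝ}
    (hF : ∀ r φ, 0 < r → F (r * cos φ, r * sin φ) = g φ) :
    ∫ x, F x ∂((gaussianReal 0 1).prod (gaussianReal 0 1)) =
      (∫ r in Set.Ioi (0 : ℝ), r * ((2 * π)⁻¹ * rexp (-r ^ 2 / 2))) *
        ∫ φ in Set.Ioo (-π) π, g φ := by
  rw [integral_gaussian_prod, ← integral_comp_polarCoord_symm, polarCoord_target,
    Measure.volume_eq_prod, ← setIntegral_prod_mul]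
  refine setIntegral_congr_fun (measurableSet_Ioi.prod measurableSet_Ioo) fun x hx => ?_
  have h0 : 0 < x.1 := hx.1
  simp only [polarCoord_symm_apply, smul_eq_mul]
  rw [hF x.1 x.2 h0]
  have : (x.1 * cos x.2) ^ 2 + (x.1 * sin x.2) ^ 2 = x.1 ^ 2 := by
    linear_combination x.1 ^ 2 * Real.sin_sq_add_cos_sq x.2
  rw [this]
  ring

/-- The integrand has period `π`, so the integral is twice that over `(-π/2, π/2)`. There the cosine
is positive and the sine changes sign only at `-β`, giving `2 ((π/2 + β) - (π/2 - β))`. -/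
lemma integral_sign_cos_mul_sign_sin {β : ℝ} (h1 : -(π / 2) ≤ β) (h2 : β ≤ π / 2) :
    ∫ φ in Set.Ioo (-π) π, Real.sign (cos φ) * Real.sign (sin (φ + β)) = 4 * β := by
  have hpi := Real.pi_pos
  set f : ℝ → ℝ := fun φ => Real.sign (cos φ) * Real.sign (sin (φ + β)) with hf
  have hper : Function.Periodic f π := by
    intro φ
    simp only [hf, Real.cos_add_pi, Real.sign_neg]
    rw [show φ + π + β = φ + β + π by ring, Real.sin_add_pi, Real.sign_neg]
    ring
  have hm : Measurable f :=
    (measurable_sign.comp Real.measurable_cos).mul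
      (measurable_sign.comp (Real.measurable_sin.comp (by fun_prop)))
  have hint : ∀ a b, IntervalIntegrable f volume a b := by
    intro a b
    refine (intervalIntegrable_const (c := (1 : ℝ))).mono_fun hm.aestronglyMeasurable
      (ae_of_all _ fun φ => ?_)
    simp only [Real.norm_eq_abs, hf, abs_mul, abs_one]
    simpa using mul_le_one₀ (abs_sign_le_one (cos φ)) (abs_nonneg _) (abs_sign_le_one _)
  rw [← integral_Ioc_eq_integral_Ioo, ← intervalIntegral.integral_of_le (by linarith),
    ← intervalIntegral.integral_add_adjacent_intervals (hint (-π) 0) (hint 0 π)]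
  have e1 := hper.intervalIntegral_add_eq (-π) (-(π / 2))
  have e2 := hper.intervalIntegral_add_eq 0 (-(π / 2))
  rw [neg_add_cancel] at e1
  rw [zero_add] at e2
  rw [e1, e2, show -(π / 2) + π = π / 2 by ring,
    ← intervalIntegral.integral_add_adjacent_intervals (hint (-(π / 2)) (-β)) (hint (-β) (π / 2))]
  have i1 : ∫ φ in (-(π / 2))..(-β), f φ = ∫ φ in (-(π / 2))..(-β), (-1 : ℝ) := by
    rw [intervalIntegral.integral_of_le (by linarith), intervalIntegral.integral_of_le (by linarith),
      integral_Ioc_eq_integral_Ioo, integral_Ioc_eq_integral_Ioo]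
    refine setIntegral_congr_fun measurableSet_Ioo fun φ hφ => ?_
    obtain ⟨ha, hb⟩ := hφ
    simp only [hf]
    rw [Real.sign_of_pos (Real.cos_pos_of_mem_Ioo ⟨ha, by linarith⟩),
      Real.sign_of_neg (Real.sin_neg_of_neg_of_neg_pi_lt (by linarith) (by linarith))]
    norm_num
  have i2 : ∫ φ in (-β)..(π / 2), f φ = ∫ φ in (-β)..(π / 2), (1 : ℝ) := by
    rw [intervalIntegral.integral_of_le (by linarith), intervalIntegral.integral_of_le (by linarith),
      integral_Ioc_eq_integral_Ioo, integral_Ioc_eq_integral_Ioo]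
    refine setIntegral_congr_fun measurableSet_Ioo fun φ hφ => ?_
    obtain ⟨ha, hb⟩ := hφ
    simp only [hf]
    rw [Real.sign_of_pos (Real.cos_pos_of_mem_Ioo ⟨by linarith, hb⟩),
      Real.sign_of_pos (Real.sin_pos_of_pos_of_lt_pi (by linarith) (by linarith))]
    norm_num
  rw [i1, i2, intervalIntegral.integral_const, intervalIntegral.integral_const]
  simp only [smul_eq_mul]
  ring

/-- For independent standard Gaussian `x`, `y` and `u = r x + √(1 - r²) y`, the expected product
of the signs of `x` and `u` is `(2 / π) arcsin r`. -/
lemma integral_sign_mul_sign_gaussian {r : ℝ} (h1 : -1 ≤ r) (h2 : r ≤ 1) :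
    ∫ x, Real.sign x.1 * Real.sign (r * x.1 + √(1 - r ^ 2) * x.2)
      ∂((gaussianReal 0 1).prod (gaussianReal 0 1)) = 2 / π * arcsin r := by
  have hpi := Real.pi_pos
  -- Total mass one determines the radial integral as `1 / (2π)` without computing it.
  have hmass := integral_gaussian_prod_polar (F := fun _ => 1) (g := fun _ => 1)
    fun _ _ _ => rfl
  rw [integral_gaussian_prod_polar (g := fun φ => Real.sign (cos φ) *
    Real.sign (sin (φ + arcsin r))) ?_, integral_sign_cos_mul_sign_sin
      (Real.neg_pi_div_two_le_arcsin r) (Real.arcsin_le_pi_div_two r)]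
  · simp only [integral_const, probReal_univ, smul_eq_mul, mul_one, measureReal_restrict_apply_univ,
      Real.volume_real_Ioo_of_le (show -π ≤ π by linarith)] at hmass
    set I := ∫ r in Set.Ioi (0 : ℝ), r * ((2 * π)⁻¹ * rexp (-r ^ 2 / 2))
    have hI : I = 1 / (2 * π) := by
      rw [eq_div_iff (by positivity)]
      linarith
    rw [hI]
    field_simp
    ring
  · intro s φ hs
    -- In polar coordinates the second Gaussian variable is the radius times `sin (φ + arcsin r)`.
    rw [sign_pos_mul hs, ← Real.cos_arcsin, show r * (s * cos φ) + cos (arcsin r) * (s * sin φ) =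
      s * (sin φ * cos (arcsin r) + cos φ * sin (arcsin r)) by
        rw [Real.sin_arcsin h1 h2]; ring, sign_pos_mul hs, Real.sin_add]

variable {Ω : Type*} {mΩ : MeasurableSpace Ω} {μ : Measure Ω} {p : ℕ}

lemma dotProduct_single_add_single (S : Matrix (Fin p) (Fin p) ℝ) (i j : Fin p) (a b : ℝ) :
    (Pi.single i a + Pi.single j b : Fin p → ℝ) ⬝ᵥ S.mulVec (Pi.single i a + Pi.single j b) =
      a ^ 2 * S i i + a * b * (S i j + S j i) + b ^ 2 * S j j := by
  simp only [Matrix.mulVec_add, add_dotProduct, dotProduct_add, Matrix.mulVec_single,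
    single_dotProduct, Pi.smul_apply, Matrix.col_apply,
    MulOpposite.smul_eq_mul_unop, MulOpposite.unop_op]
  ring

lemma charFun_gaussian_single (S : Matrix (Fin p) (Fin p) ℝ) (hS : S.PosSemidef) (i j : Fin p)
    (a b : ℝ) :
    ∫ z, Complex.exp ((a * z i + b * z j : ℝ) * Complex.I)
      ∂(multivariateGaussian (0 : EuclideanSpace ℝ (Fin p)) S) =
      Complex.exp (-((a ^ 2 * S i i + a * b * (S i j + S j i) + b ^ 2 * S j j : ℝ) : ℂ) / 2) := by
  have h := charFun_multivariateGaussian (μ := 0) hS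
    (EuclideanSpace.single i a + EuclideanSpace.single j b)
  rw [charFun_apply] at h
  simp only [inner_zero_right, Complex.ofReal_zero, zero_mul, zero_sub, inner_add_right,
    EuclideanSpace.inner_single_right] at h
  have e : (EuclideanSpace.single i a + EuclideanSpace.single j b : EuclideanSpace ℝ (Fin p)).ofLp =
    (Pi.single i a + Pi.single j b : Fin p → ℝ) := by
    ext k; simp [Pi.single_apply]
  rw [e, dotProduct_single_add_single] at h
  rw [neg_div]
  simpa [mul_comm] using h

/-- The joint law of differences of coordinates of three independent Gaussian vectors. -/
lemma hasLaw_gaussian_differences {S : Matrix (Fin p) (Fin p) ℝ} (hS : S.PosSemidef)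
    (hdiag : ∀ j, S j j = 1) {Z : Fin 3 → Ω → EuclideanSpace ℝ (Fin p)} (hZ : iIndepFun Z μ)
    (hlaw : ∀ t, HasLaw (Z t) (multivariateGaussian 0 S) μ) (i j : Fin p)
    (h1 : -1 ≤ S i j / 2) (h2 : S i j / 2 ≤ 1) :
    HasLaw (fun ω => (Z 0 ω i - Z 1 ω i, Z 0 ω j - Z 2 ω j))
      (((gaussianReal 0 1).prod (gaussianReal 0 1)).map fun x =>
        (√2 * x.1, √2 * (S i j / 2 * x.1 + √(1 - (S i j / 2) ^ 2) * x.2))) μ := by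
  have hprob := hZ.isProbabilityMeasure
  have hZm : ∀ t k, AEMeasurable (fun ω => Z t ω k) μ := fun t k =>
    (show Measurable fun z : EuclideanSpace ℝ (Fin p) => z k by fun_prop).comp_aemeasurable
      (hlaw t).aemeasurable
  have hm : AEMeasurable (fun ω => (Z 0 ω i - Z 1 ω i, Z 0 ω j - Z 2 ω j)) μ :=
    ((hZm 0 i).sub (hZm 1 i)).prodMk ((hZm 0 j).sub (hZm 2 j))
  have hm2 : Measurable fun x : ℝ × ℝ =>
      (√2 * x.1, √2 * (S i j / 2 * x.1 + √(1 - (S i j / 2) ^ 2) * x.2)) := by fun_prop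
  have hsym : S j i = S i j := by simpa using hS.1.apply i j
  refine ⟨hm, ?_⟩
  have := Measure.isProbabilityMeasure_map (μ := μ) hm
  have := Measure.isProbabilityMeasure_map
    (μ := (gaussianReal 0 1).prod (gaussianReal 0 1)) hm2.aemeasurable
  apply Measure.ext_of_charFunDual
  ext L
  set a := L (1, 0) with ha
  set b := L (0, 1) with hb
  have hL : ∀ u v, L (u, v) = a * u + b * v := by
    intro u v
    have : ((u, v) : ℝ × ℝ) = u • (1, 0) + v • (0, 1) := by simp
    rw [this, map_add, map_smul, map_smul, smul_eq_mul, smul_eq_mul]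
    ring
  rw [charFunDual_apply, charFunDual_apply, integral_map hm (by fun_prop),
    integral_map hm2.aemeasurable (by fun_prop)]
  simp only [hL]
  -- The characteristic function factors over the three independent vectors. The zero terms give
  -- every factor the two-coordinate shape of `charFun_gaussian_single`.
  let g : Fin 3 → EuclideanSpace ℝ (Fin p) → ℂ :=
    ![fun z => Complex.exp ((a * z i + b * z j : ℝ) * Complex.I),
      fun z => Complex.exp (((-a) * z i + 0 * z i : ℝ) * Complex.I),
      fun z => Complex.exp (((-b) * z j + 0 * z j : ℝ) * Complex.I)]
  have hg : ∀ k, Measurable (g k) := by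
    intro k
    fin_cases k <;> simp only [g] <;> (dsimp; fun_prop)
  have hl := hZ.integral_fun_prod_comp (f := g) (fun t => (hlaw t).aemeasurable)
    fun t => (hg t).aestronglyMeasurable
  have hgl : ∀ k, ∫ ω, g k (Z k ω) ∂μ = ∫ z, g k z ∂(multivariateGaussian 0 S) := fun k =>
    (hlaw k).integral_comp (hg k).aestronglyMeasurable
  simp only [hgl, Fin.prod_univ_three] at hl
  simp only [g, Matrix.cons_val_zero, Matrix.cons_val_one, Matrix.cons_val,
    charFun_gaussian_single S hS] at hl
  have hle : ∀ ω, Complex.exp ((a * (Z 0 ω i - Z 1 ω i) + b * (Z 0 ω j - Z 2 ω j) : ℝ) *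
      Complex.I) = Complex.exp ((a * Z 0 ω i + b * Z 0 ω j : ℝ) * Complex.I) *
      Complex.exp (((-a) * Z 1 ω i + 0 * Z 1 ω i : ℝ) * Complex.I) *
      Complex.exp (((-b) * Z 2 ω j + 0 * Z 2 ω j : ℝ) * Complex.I) := by
    intro ω
    rw [← Complex.exp_add, ← Complex.exp_add]
    congr 1
    push_cast
    ring
  rw [integral_congr_ae (ae_of_all _ hle), hl]
  set r := S i j / 2 with hr
  set s := √(1 - r ^ 2) with hs
  have hss : s ^ 2 = 1 - r ^ 2 := Real.sq_sqrt (by nlinarith)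
  have hre : ∀ x : ℝ × ℝ, Complex.exp ((a * (√2 * x.1) + b * (√2 * (r * x.1 + s * x.2)) : ℝ) *
      Complex.I) = Complex.exp ((√2 * (a + b * r) : ℝ) * x.1 * Complex.I) *
      Complex.exp ((√2 * (b * s) : ℝ) * x.2 * Complex.I) := by
    intro x
    rw [← Complex.exp_add]
    congr 1
    push_cast
    ring
  rw [integral_congr_ae (ae_of_all _ hre), integral_prod_mul
    (fun x : ℝ => Complex.exp ((√2 * (a + b * r) : ℝ) * x * Complex.I))
    (fun x : ℝ => Complex.exp ((√2 * (b * s) : ℝ) * x * Complex.I)),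
    ← charFun_apply_real, ← charFun_apply_real, charFun_gaussianReal, charFun_gaussianReal,
    ← Complex.exp_add, ← Complex.exp_add, ← Complex.exp_add]
  congr 1
  -- Both differences have variance 2 and their covariance is `S i j`, hence the correlation `S i j
  -- / 2`.
  have key : -(a ^ 2 * S i i + a * b * (S i j + S j i) + b ^ 2 * S j j) / 2 +
      -((-a) ^ 2 * S i i + (-a) * 0 * (S i i + S i i) + 0 ^ 2 * S i i) / 2 +
      -((-b) ^ 2 * S j j + (-b) * 0 * (S j j + S j j) + 0 ^ 2 * S j j) / 2 =
      -(√2 * (a + b * r)) ^ 2 / 2 + -(√2 * (b * s)) ^ 2 / 2 := by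
    rw [mul_pow, mul_pow, mul_pow b s, hss, Real.sq_sqrt (by norm_num), hsym, hdiag, hdiag, hr]
    ring
  have keyc := congrArg (fun x : ℝ => (x : ℂ)) key
  push_cast at keyc ⊢
  rw [keyc]
  ring

lemma integral_sign_gaussian_differences {S : Matrix (Fin p) (Fin p) ℝ} (hS : S.PosSemidef)
    (hdiag : ∀ j, S j j = 1) {Z : Fin 3 → Ω → EuclideanSpace ℝ (Fin p)} (hZ : iIndepFun Z μ)
    (hlaw : ∀ t, HasLaw (Z t) (multivariateGaussian 0 S) μ) (i j : Fin p)
    (h1 : -1 ≤ S i j / 2) (h2 : S i j / 2 ≤ 1) :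
    ∫ ω, Real.sign (Z 0 ω i - Z 1 ω i) * Real.sign (Z 0 ω j - Z 2 ω j) ∂μ =
      2 / π * arcsin (S i j / 2) := by
  have hl := hasLaw_gaussian_differences hS hdiag hZ hlaw i j h1 h2
  have hm : Measurable fun x : ℝ × ℝ => Real.sign x.1 * Real.sign x.2 :=
    (measurable_sign.comp measurable_fst).mul (measurable_sign.comp measurable_snd)
  have := hl.integral_comp hm.aestronglyMeasurable
  simp only [Function.comp_def] at this
  rw [this, integral_map (by fun_prop) hm.aestronglyMeasurable,
    ← integral_sign_mul_sign_gaussian h1 h2]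
  have h2 : 0 < √2 := by positivity
  simp only [sign_pos_mul h2]

/-- Read off from the first coordinate of the joint law with `j = i`; the third vector is there only
to fit that law. -/
lemma gaussian_differences_ne_zero {S : Matrix (Fin p) (Fin p) ℝ} (hS : S.PosSemidef)
    (hdiag : ∀ j, S j j = 1) {Z : Fin 3 → Ω → EuclideanSpace ℝ (Fin p)} (hZ : iIndepFun Z μ)
    (hlaw : ∀ t, HasLaw (Z t) (multivariateGaussian 0 S) μ) (i : Fin p) :
    ∀ᵐ ω ∂μ, Z 0 ω i ≠ Z 1 ω i := by
  have hl := hasLaw_gaussian_differences hS hdiag hZ hlaw i i (by rw [hdiag]; norm_num)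
    (by rw [hdiag]; norm_num)
  have h0 : ∀ᵐ x ∂(((gaussianReal 0 1).prod (gaussianReal 0 1)).map fun x : ℝ × ℝ =>
      (√2 * x.1, √2 * (S i i / 2 * x.1 + √(1 - (S i i / 2) ^ 2) * x.2))), x.1 ≠ 0 := by
    have hms : MeasurableSet {x : ℝ × ℝ | x.1 ≠ 0} := by measurability
    rw [ae_map_iff (by fun_prop) hms]
    have := nullSingletonClass_gaussianReal (μ := 0) (v := 1) one_ne_zero
    have hx : ∀ᵐ x ∂(gaussianReal 0 1), x ≠ 0 := by
      rw [ae_iff]; simp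
    have h2 : √2 ≠ 0 := by positivity
    have := (Measure.quasiMeasurePreserving_fst (μ := gaussianReal 0 1)
      (ν := gaussianReal 0 1)).ae hx
    filter_upwards [this] with x hx
    exact mul_ne_zero h2 hx
  have := (hl.ae_iff (p := fun x => x.1 ≠ 0) (by fun_prop)).2 h0
  filter_upwards [this] with ω hω
  exact sub_ne_zero.1 hω

end GaussianSigns

/-! ### Spearman's correlation as a sum of products of signs -/

section Ranks

variable {n : ℕ}

/-- The sum over all triples of `sign (a t - a s) * sign (b t - b u)`. -/
def signSum (a b : Fin n → ℝ) : ℝ :=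
  ∑ t, (∑ s, Real.sign (a t - a s)) * ∑ u, Real.sign (b t - b u)

lemma sign_sub_comm (x y : ℝ) : Real.sign (x - y) = -Real.sign (y - x) := by
  rw [← Real.sign_neg, neg_sub]

lemma rank_eq (v : Fin n → ℝ) (t : Fin n) :
    rank v t = ((n : ℝ) + 1) / 2 + (∑ s, Real.sign (v t - v s)) / 2 := by
  classical
  have hn : (n : ℝ) = ∑ _s : Fin n, (1 : ℝ) := by simp
  unfold rank
  rw [hn, Finset.card_filter, Finset.card_filter]
  push_cast
  have key : ∑ s, Real.sign (v t - v s) = ∑ s, ((2 * (if v s < v t then (1 : ℝ) else 0) +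
      (if v s = v t then (1 : ℝ) else 0)) - 1) := by
    refine Finset.sum_congr rfl fun s _ => ?_
    rcases lt_trichotomy (v s) (v t) with h | h | h
    · rw [Real.sign_of_pos (sub_pos.2 h), if_pos h, if_neg h.ne]; norm_num
    · rw [h]; simp
    · rw [Real.sign_of_neg (sub_neg.2 h), if_neg h.not_gt, if_neg h.ne']; norm_num
  rw [key, Finset.sum_sub_distrib, Finset.sum_add_distrib, ← Finset.mul_sum]
  ring

lemma sum_sign_sub_eq_zero (v : Fin n → ℝ) : ∑ t, ∑ s, Real.sign (v t - v s) = 0 := by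
  have h : ∑ t, ∑ s, Real.sign (v t - v s) = -∑ t, ∑ s, Real.sign (v t - v s) := by
    conv_lhs => rw [Finset.sum_comm]
    simp only [← Finset.sum_neg_distrib, ← sign_sub_comm]
  linarith

lemma rank_sub_mean (hn : 0 < n) (v : Fin n → ℝ) (t : Fin n) :
    rank v t - mean (rank v) = (∑ s, Real.sign (v t - v s)) / 2 := by
  have hn' : (n : ℝ) ≠ 0 := by exact_mod_cast hn.ne'
  have : mean (rank v) = ((n : ℝ) + 1) / 2 := by
    unfold mean
    simp only [rank_eq, Finset.sum_add_distrib, ← Finset.sum_div, sum_sign_sub_eq_zero]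
    simp
    field_simp
  rw [this, rank_eq]
  ring

/-- The smallest and the largest of the three numbers contribute `1` each, the middle one `-1`. -/
lemma sign_triple {x y z : ℝ} (hxy : x ≠ y) (hxz : x ≠ z) (hyz : y ≠ z) :
    Real.sign (x - y) * Real.sign (x - z) + Real.sign (y - x) * Real.sign (y - z) +
      Real.sign (z - y) * Real.sign (z - x) = 1 := by
  rw [sign_sub_comm y x, sign_sub_comm z x, sign_sub_comm z y]
  rcases lt_or_gt_of_ne hxy with h1 | h1 <;> rcases lt_or_gt_of_ne hxz with h2 | h2 <;>
    rcases lt_or_gt_of_ne hyz with h3 | h3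
  all_goals first
    | (exfalso; linarith)
    | (first
        | rw [Real.sign_of_neg (sub_neg.2 h1)]
        | rw [Real.sign_of_pos (sub_pos.2 h1)]
       first
        | rw [Real.sign_of_neg (sub_neg.2 h2)]
        | rw [Real.sign_of_pos (sub_pos.2 h2)]
       first
        | rw [Real.sign_of_neg (sub_neg.2 h3)]
        | rw [Real.sign_of_pos (sub_pos.2 h3)]
       norm_num)

lemma sign_sub_sq {x y : ℝ} (hxy : x ≠ y) : Real.sign (x - y) * Real.sign (x - y) = 1 := by
  rcases Real.sign_apply_eq_of_ne_zero _ (sub_ne_zero.2 hxy) with h | h <;> rw [h] <;> norm_num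

/-- Sum the three relabelings of the triple sum: every index triple contributes `1`, except the `n`
triples with all indices equal, which contribute `0`. -/
lemma signSum_self {v : Fin n → ℝ} (hv : Function.Injective v) :
    signSum v v = ((n : ℝ) ^ 3 - n) / 3 := by
  have e1 : signSum v v = ∑ t, ∑ s, ∑ u, Real.sign (v t - v s) * Real.sign (v t - v u) := by
    simp only [signSum, Finset.sum_mul_sum]
  have e2 : signSum v v = ∑ t, ∑ s, ∑ u, Real.sign (v s - v t) * Real.sign (v s - v u) := by
    rw [e1, Finset.sum_comm]
  have e3 : signSum v v = ∑ t, ∑ s, ∑ u, Real.sign (v u - v s) * Real.sign (v u - v t) := by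
    rw [e1, Finset.sum_comm]
    rw [Finset.sum_comm]
    have : ∀ t, ∑ s, ∑ u, Real.sign (v t - v s) * Real.sign (v t - v u) =
        ∑ u, ∑ s, Real.sign (v t - v s) * Real.sign (v t - v u) := fun t => Finset.sum_comm
    simp only [this]
    rw [Finset.sum_comm]
    refine Finset.sum_congr rfl fun t _ => Finset.sum_comm
  have h3 : signSum v v + signSum v v + signSum v v = ∑ t : Fin n, ∑ s : Fin n, ∑ u : Fin n,
      (1 - if t = s then (if s = u then (1 : ℝ) else 0) else 0) := by
    nth_rewrite 1 [e1]
    nth_rewrite 1 [e2]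
    rw [e3]
    simp only [← Finset.sum_add_distrib]
    refine Finset.sum_congr rfl fun t _ => Finset.sum_congr rfl fun s _ =>
      Finset.sum_congr rfl fun u _ => ?_
    by_cases hts : t = s
    · subst hts
      by_cases htu : t = u
      · subst htu; simp
      · have := sign_sub_sq (hv.ne (Ne.symm htu))
        simp [htu, this]
    · by_cases htu : t = u
      · subst htu
        have := sign_sub_sq (hv.ne (Ne.symm hts))
        simp [hts, this]
      · by_cases hsu : s = u
        · subst hsu
          have := sign_sub_sq (hv.ne hts)
          simp [hts, this]
        · simpa [hts] using sign_triple (hv.ne hts) (hv.ne htu) (hv.ne hsu)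
  have h4 : ∑ t : Fin n, ∑ s : Fin n, ∑ u : Fin n,
      (1 - if t = s then (if s = u then (1 : ℝ) else 0) else 0) = (n : ℝ) ^ 3 - n := by
    have : ∀ t s : Fin n, ∑ u : Fin n, (if t = s then (if s = u then (1 : ℝ) else 0) else 0) =
        if t = s then 1 else 0 := by
      intro t s
      split_ifs <;> simp
    simp only [Finset.sum_sub_distrib, this]
    simp
    ring
  linarith

lemma spearman_eq {a b : Fin n → ℝ} (hn : 2 ≤ n) (ha : Function.Injective a)
    (hb : Function.Injective b) : spearman a b = 3 * signSum a b / ((n : ℝ) ^ 3 - n) := by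
  have hn2 : (2 : ℝ) ≤ n := by exact_mod_cast hn
  have hpos : 0 < (n : ℝ) ^ 3 - n := by nlinarith [sq_nonneg ((n : ℝ) - 1)]
  have hden : ∀ v : Fin n → ℝ, Function.Injective v →
      ∑ t, (rank v t - mean (rank v)) ^ 2 = ((n : ℝ) ^ 3 - n) / 12 := by
    intro v hv
    have h := signSum_self hv
    simp only [rank_sub_mean (by omega : 0 < n), div_pow, ← Finset.sum_div]
    simp only [signSum, ← sq] at h
    rw [h]
    ring
  unfold spearman pearson
  rw [hden a ha, hden b hb, Real.mul_self_sqrt (by positivity)]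
  simp only [rank_sub_mean (by omega : 0 < n)]
  rw [show ∑ t, (∑ s, Real.sign (a t - a s)) / 2 * ((∑ s, Real.sign (b t - b s)) / 2) =
    signSum a b / 4 by
      rw [signSum, Finset.sum_div]
      exact Finset.sum_congr rfl fun t _ => by ring]
  field_simp
  ring

lemma spearman_self {a : Fin n → ℝ} (hn : 2 ≤ n) (ha : Function.Injective a) :
    spearman a a = 1 := by
  have hn2 : (2 : ℝ) ≤ n := by exact_mod_cast hn
  have hpos : 0 < (n : ℝ) ^ 3 - n := by nlinarith [sq_nonneg ((n : ℝ) - 1)]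
  rw [spearman_eq hn ha ha, signSum_self ha, mul_div_cancel₀ _ (by norm_num), div_self hpos.ne']

lemma spearman_comm (a b : Fin n → ℝ) : spearman a b = spearman b a := by
  unfold spearman pearson
  rw [mul_comm (Real.sqrt _)]
  congr 1
  exact Finset.sum_congr rfl fun t _ => mul_comm _ _

lemma card_distinctTriples : ((distinctTriples n).card : ℝ) = n * (n - 1) * (n - 2) := by
  have h : ((distinctTriples n).card : ℝ) = ∑ t : Fin n, ∑ s : Fin n, ∑ u : Fin n,
      (1 - (if t = s then (1 : ℝ) else 0) - (if t = u then (1 : ℝ) else 0) -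
        (if s = u then (1 : ℝ) else 0) +
        2 * if t = s then (if s = u then (1 : ℝ) else 0) else 0) := by
    rw [distinctTriples, Finset.card_filter]
    push_cast
    rw [Fintype.sum_prod_type]
    refine Finset.sum_congr rfl fun t _ => ?_
    rw [Fintype.sum_prod_type]
    refine Finset.sum_congr rfl fun s _ => Finset.sum_congr rfl fun u _ => ?_
    by_cases h1 : t = s <;> by_cases h2 : t = u <;> by_cases h3 : s = u <;> simp_all
    norm_num
  have : ∀ t s : Fin n, ∑ u : Fin n, (if t = s then (if s = u then (1 : ℝ) else 0) else 0) =
      if t = s then 1 else 0 := by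
    intro t s
    split_ifs <;> simp
  rw [h]
  simp only [Finset.sum_sub_distrib, Finset.sum_add_distrib, ← Finset.mul_sum, this]
  simp
  ring

/-- The triples with `s = u` form an unnormalized Kendall's tau, of lower order; those with `t = s`
or `t = u` vanish. -/
lemma signSum_eq (a b : Fin n → ℝ) : signSum a b =
    (∑ q ∈ distinctTriples n, Real.sign (a q.1 - a q.2.1) * Real.sign (b q.1 - b q.2.2)) +
      ∑ t, ∑ s, Real.sign (a t - a s) * Real.sign (b t - b s) := by
  have e1 : signSum a b = ∑ t, ∑ s, ∑ u, Real.sign (a t - a s) * Real.sign (b t - b u) := by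
    simp only [signSum, Finset.sum_mul_sum]
  have e2 : ∑ t, ∑ s, Real.sign (a t - a s) * Real.sign (b t - b s) =
      ∑ t, ∑ s, ∑ u, if s = u then Real.sign (a t - a s) * Real.sign (b t - b u) else 0 := by
    simp
  rw [e1, e2, distinctTriples, Finset.sum_filter, Fintype.sum_prod_type, ← Finset.sum_add_distrib]
  refine Finset.sum_congr rfl fun t _ => ?_
  rw [Fintype.sum_prod_type, ← Finset.sum_add_distrib]
  refine Finset.sum_congr rfl fun s _ => ?_
  rw [← Finset.sum_add_distrib]
  refine Finset.sum_congr rfl fun u _ => ?_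
  by_cases h1 : t = s <;> by_cases h2 : t = u <;> by_cases h3 : s = u <;> simp_all

lemma abs_sum_sign_le (a b : Fin n → ℝ) :
    |∑ t, ∑ s, Real.sign (a t - a s) * Real.sign (b t - b s)| ≤ (n : ℝ) * (n - 1) := by
  have : (n : ℝ) * (n - 1) = ∑ t : Fin n, ∑ s : Fin n, (1 - if t = s then (1 : ℝ) else 0) := by
    simp only [Finset.sum_sub_distrib]
    simp
    ring
  rw [this]
  refine (Finset.abs_sum_le_sum_abs _ _).trans (Finset.sum_le_sum fun t _ =>
    (Finset.abs_sum_le_sum_abs _ _).trans (Finset.sum_le_sum fun s _ => ?_))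
  by_cases h : t = s
  · subst h; simp
  · rw [if_neg h, abs_mul, sub_zero]
    exact mul_le_one₀ (abs_sign_le_one _) (abs_nonneg _) (abs_sign_le_one _)

/-- The U-statistic which is the main part of Spearman's rank correlation. -/
def signU (a b : Fin n → ℝ) : ℝ :=
  (∑ q ∈ distinctTriples n, Real.sign (a q.1 - a q.2.1) * Real.sign (b q.1 - b q.2.2)) /
    ((distinctTriples n).card : ℝ)

lemma abs_spearman_sub_le {a b : Fin n → ℝ} (hn : 3 ≤ n) (ha : Function.Injective a)
    (hb : Function.Injective b) {θ : ℝ} (hθ : |θ| ≤ 1 / 3) :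
    |spearman a b - 3 * θ| ≤ 3 * |signU a b - θ| + 6 / n := by
  have hn3 : (3 : ℝ) ≤ n := by exact_mod_cast hn
  set τ := ∑ t, ∑ s, Real.sign (a t - a s) * Real.sign (b t - b s) with hτ
  have hτ' : |τ / ((n : ℝ) * (n - 1))| ≤ 1 := by
    rw [abs_div, abs_of_pos (show (0 : ℝ) < n * (n - 1) by nlinarith),
      div_le_one (by nlinarith)]
    exact abs_sum_sign_le a b
  have hN : ((n : ℝ) * (n - 1) * (n - 2)) ≠ 0 := by
    have : 0 < (n : ℝ) * (n - 1) * (n - 2) :=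
      mul_pos (mul_pos (by linarith) (by linarith)) (by linarith)
    exact this.ne'
  have hs : signSum a b = n * (n - 1) * (n - 2) * signU a b + τ := by
    rw [signSum_eq, signU, card_distinctTriples, mul_div_cancel₀ _ hN]
  set τ' := τ / ((n : ℝ) * (n - 1)) with hτd
  have h1 : (n : ℝ) - 1 ≠ 0 := by linarith
  have h2 : (n : ℝ) ≠ 0 := by linarith
  have hττ : τ = n * (n - 1) * τ' := by rw [hτd]; field_simp
  -- Spearman's correlation is `3 (n - 2) / (n + 1)` times the U-statistic plus `3 / (n + 1)` times
  -- Kendall's tau; the second summand here is the resulting bias.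
  have hr : spearman a b - 3 * θ =
      3 * ((n - 2) / (n + 1)) * (signU a b - θ) + 3 / (n + 1) * (τ' - 3 * θ) := by
    rw [spearman_eq (by omega) ha hb, hs, hττ,
      show (n : ℝ) ^ 3 - n = n * (n - 1) * (n + 1) by ring]
    have h3 : (n : ℝ) + 1 ≠ 0 := by linarith
    field_simp
    ring
  rw [hr]
  refine (abs_add_le _ _).trans (add_le_add ?_ ?_)
  · rw [abs_mul]
    refine mul_le_mul_of_nonneg_right ?_ (abs_nonneg _)
    rw [abs_of_nonneg (by
      have : (0 : ℝ) ≤ (n - 2) / (n + 1) := div_nonneg (by linarith) (by linarith)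
      linarith)]
    have : ((n : ℝ) - 2) / (n + 1) ≤ 1 := by
      rw [div_le_one (by linarith)]; linarith
    linarith
  · rw [abs_mul, abs_of_pos (show (0 : ℝ) < 3 / (n + 1) by positivity)]
    have h4 : |τ' - 3 * θ| ≤ 2 := by
      rw [abs_le] at hτ' hθ ⊢
      constructor <;> linarith [hτ'.1, hτ'.2, hθ.1, hθ.2]
    calc 3 / ((n : ℝ) + 1) * |τ' - 3 * θ| ≤ 3 / (n + 1) * 2 := by gcongr
      _ ≤ 3 / n * 2 := by gcongr; linarith
      _ = 6 / n := by ring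

end Ranks

/-! ### Perturbation of linear systems -/

section Perturbation

variable {κ : Type*} [Fintype κ]

lemma abs_sum_mul_le {x y : κ → ℝ} {a m : ℝ} (hm : 0 ≤ m) (hx : ∑ j, |x j| ≤ a)
    (hy : ∀ j, |y j| ≤ m) : |∑ j, x j * y j| ≤ a * m := by
  calc |∑ j, x j * y j| ≤ ∑ j, |x j| * m := by
        refine (Finset.abs_sum_le_sum_abs _ _).trans (Finset.sum_le_sum fun j _ => ?_)
        rw [abs_mul]
        exact mul_le_mul_of_nonneg_left (hy j) (abs_nonneg _)
    _ = (∑ j, |x j|) * m := by rw [Finset.sum_mul]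
    _ ≤ a * m := mul_le_mul_of_nonneg_right hx hm

lemma sum_abs_mulVec_le {A : Matrix κ κ ℝ} {a : ℝ} (hA : ∀ j, ∑ i, |A i j| ≤ a) (x : κ → ℝ) :
    ∑ i, |A.mulVec x i| ≤ a * ∑ j, |x j| := by
  calc ∑ i, |A.mulVec x i| ≤ ∑ i, ∑ j, |A i j| * |x j| := by
        refine Finset.sum_le_sum fun i _ => ?_
        rw [Matrix.mulVec, dotProduct]
        refine (Finset.abs_sum_le_sum_abs _ _).trans_eq ?_
        simp only [abs_mul]
    _ = ∑ j, (∑ i, |A i j|) * |x j| := by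
        rw [Finset.sum_comm]
        simp only [Finset.sum_mul]
    _ ≤ a * ∑ j, |x j| := by
        rw [Finset.mul_sum]
        exact Finset.sum_le_sum fun j _ => mul_le_mul_of_nonneg_right (hA j) (abs_nonneg _)

variable [DecidableEq κ]

/-- `Q` is the inverse of `A`, with absolute row and column sums at most `G`, and `B` is
symmetric and so close to `A` that it is invertible. -/
structure IsPerturbation (Q A B : Matrix κ κ ℝ) (G η : ℝ) : Prop where
  mul_eq_one : Q * A = 1
  row_le : ∀ i, ∑ j, |Q i j| ≤ G
  col_le : ∀ j, ∑ i, |Q i j| ≤ G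
  sub_row_le : ∀ i, ∑ j, |(B - A) i j| ≤ η
  sub_col_le : ∀ j, ∑ i, |(B - A) i j| ≤ η
  nonneg : 0 ≤ G
  mul_le : G * η ≤ 1 / 8
  symm : B.transpose = B

namespace IsPerturbation

variable {Q A B : Matrix κ κ ℝ} {G η : ℝ} (h : IsPerturbation Q A B G η)
include h

lemma eq_sub (x : κ → ℝ) : x = Q.mulVec (B.mulVec x - (B - A).mulVec x) := by
  rw [Matrix.sub_mulVec, sub_sub_cancel, Matrix.mulVec_mulVec, h.mul_eq_one, Matrix.one_mulVec]

/-- From `‖x‖ ≤ G (m + η ‖x‖)` and `G η ≤ 1 / 8` the last term is absorbed on the left, which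
produces `8 / 7`. The `ℓ₁` estimate below is the same with column sums. -/
lemma abs_le {x : κ → ℝ} {m : ℝ} (hx : ∀ i, |B.mulVec x i| ≤ m) (i : κ) :
    |x i| ≤ 8 / 7 * G * m := by
  have hη : 0 ≤ η := (Finset.sum_nonneg fun j _ => abs_nonneg _).trans (h.sub_row_le i)
  have hm : 0 ≤ m := (abs_nonneg _).trans (hx i)
  have hxn : ∀ j, |x j| ≤ ‖x‖ := fun j => norm_le_pi_norm x j
  have hD : ∀ j, |(B - A).mulVec x j| ≤ η * ‖x‖ := fun j =>
    abs_sum_mul_le (norm_nonneg _) (h.sub_row_le j) hxn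
  have hmain : ‖x‖ ≤ G * (m + η * ‖x‖) := by
    have h0 : 0 ≤ m + η * ‖x‖ := by positivity
    rw [pi_norm_le_iff_of_nonneg (mul_nonneg h.nonneg h0)]
    intro j
    have e := congrFun (h.eq_sub x) j
    rw [Real.norm_eq_abs, e]
    refine abs_sum_mul_le h0 (h.row_le j) fun l => ?_
    rw [Pi.sub_apply]
    exact (abs_sub _ _).trans (add_le_add (hx l) (hD l))
  have : G * η * ‖x‖ ≤ 1 / 8 * ‖x‖ := mul_le_mul_of_nonneg_right h.mul_le (norm_nonneg _)
  have := hxn i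
  linarith

lemma sum_abs_le (x : κ → ℝ) : ∑ i, |x i| ≤ 8 / 7 * G * ∑ i, |B.mulVec x i| := by
  have e : ∑ i, |x i| ≤ G * ∑ i, |(B.mulVec x - (B - A).mulVec x) i| := by
    conv_lhs => rw [h.eq_sub x]
    exact sum_abs_mulVec_le h.col_le _
  have e2 : ∑ i, |(B.mulVec x - (B - A).mulVec x) i| ≤
      ∑ i, |B.mulVec x i| + η * ∑ i, |x i| := by
    refine le_trans ?_ (add_le_add_right (sum_abs_mulVec_le h.sub_col_le x) _)
    rw [← Finset.sum_add_distrib]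
    exact Finset.sum_le_sum fun i _ => abs_sub _ _
  have e3 : G * η * ∑ i, |x i| ≤ 1 / 8 * ∑ i, |x i| :=
    mul_le_mul_of_nonneg_right h.mul_le (Finset.sum_nonneg fun i _ => abs_nonneg _)
  have e4 := mul_le_mul_of_nonneg_left e2 h.nonneg
  linarith

lemma exists_mulVec_eq (y : κ → ℝ) : ∃ x, B.mulVec x = y := by
  have hinj : Function.Injective (Matrix.toLin' B) := by
    rw [← LinearMap.ker_eq_bot, LinearMap.ker_eq_bot']
    intro x hx
    rw [Matrix.toLin'_apply] at hx
    funext i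
    have := h.abs_le (x := x) (m := 0) (fun j => by rw [hx]; simp) i
    rw [mul_zero] at this
    exact abs_nonpos_iff.1 this
  obtain ⟨x, hx⟩ := LinearMap.injective_iff_surjective.1 hinj y
  exact ⟨x, by rwa [Matrix.toLin'_apply] at hx⟩

lemma dotProduct_mulVec_comm (x y : κ → ℝ) : x ⬝ᵥ B.mulVec y = B.mulVec x ⬝ᵥ y := by
  rw [Matrix.dotProduct_mulVec, ← Matrix.mulVec_transpose, h.symm]

/-- The difference of the solutions of two linear systems, in a coordinate and in `ℓ₁`. -/
lemma sub_le {r s b c : κ → ℝ} {δ H : ℝ} (hc : B.mulVec c = r) (hb : A.mulVec b = s)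
    (hH : ∑ j, |b j| ≤ H) (hrs : ∀ j, |r j - s j| ≤ δ) (hBA : ∀ i j, |(B - A) i j| ≤ δ) (k : κ) :
    |c k - b k| ≤ 8 / 7 * G * (δ * (1 + H)) ∧
      ∑ j, |c j - b j| ≤ 8 / 7 * G * (Fintype.card κ * δ + η * H) := by
  have hδ : 0 ≤ δ := (abs_nonneg _).trans (hrs k)
  have hη : 0 ≤ η := (Finset.sum_nonneg fun j _ => abs_nonneg _).trans (h.sub_row_le k)
  have e : B.mulVec (c - b) = r - s - (B - A).mulVec b := by
    rw [Matrix.mulVec_sub, hc, Matrix.sub_mulVec, hb]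
    abel
  constructor
  -- Testing against column `k` of the inverse of `B` bounds one coordinate by the maximum norm of
  -- the residual, so no factor of the dimension appears, unlike in the `ℓ₁` bound.
  · obtain ⟨z, hz⟩ := h.exists_mulVec_eq (Pi.single k 1)
    have hz1 : ∑ j, |z j| ≤ 8 / 7 * G := by
      refine (h.sum_abs_le z).trans_eq ?_
      rw [hz]
      have : ∑ i, |(Pi.single k (1 : ℝ) : κ → ℝ) i| = 1 := by
        rw [Finset.sum_eq_single k]
        · simp
        · intro j _ hj; simp [hj]
        · simp
      rw [this, mul_one]
    have e1 : c k - b k = ∑ j, z j * B.mulVec (c - b) j := by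
      have := h.dotProduct_mulVec_comm (c - b) z
      rw [hz, dotProduct_single, mul_one, Pi.sub_apply] at this
      rw [this, dotProduct]
      exact Finset.sum_congr rfl fun j _ => mul_comm _ _
    rw [e1]
    have hH0 : 0 ≤ H := (Finset.sum_nonneg fun j _ => abs_nonneg _).trans hH
    refine abs_sum_mul_le (by positivity) hz1 fun j => ?_
    rw [e, Pi.sub_apply, Pi.sub_apply]
    refine (abs_sub _ _).trans ?_
    have : |(B - A).mulVec b j| ≤ H * δ := by
      rw [Matrix.mulVec, dotProduct]
      simp only [mul_comm ((B - A) j _)]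
      exact abs_sum_mul_le hδ hH fun i => hBA j i
    linarith [hrs j]
  · refine (h.sum_abs_le (c - b)).trans (mul_le_mul_of_nonneg_left ?_ (by linarith [h.nonneg]))
    rw [e]
    calc ∑ i, |(r - s - (B - A).mulVec b) i| ≤ ∑ i, (|r i - s i| + |(B - A).mulVec b i|) :=
          Finset.sum_le_sum fun i _ => abs_sub _ _
      _ = ∑ i, |r i - s i| + ∑ i, |(B - A).mulVec b i| := Finset.sum_add_distrib
      _ ≤ ∑ _i : κ, δ + η * ∑ j, |b j| :=
          add_le_add (Finset.sum_le_sum fun i _ => hrs i) (sum_abs_mulVec_le h.sub_col_le b)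
      _ ≤ Fintype.card κ * δ + η * H := by
          rw [Finset.sum_const, nsmul_eq_mul, Finset.card_univ]
          exact add_le_add_right (mul_le_mul_of_nonneg_left hH hη) _

end IsPerturbation

/-- The numerical conditions on the parameters of the adaptive problem for one variable. -/
structure Parameters (ψ G d lam : ℝ) : Prop where
  psi_pos : 0 < ψ
  psi_le : ψ ≤ G
  one_le : 1 ≤ G
  deg : 1 ≤ d
  lam_pos : 0 < lam
  lam_le : 8 * G * lam ≤ ψ ^ 2
  deg_lam_le : 4 * G * (ψ + G) * (d * lam) ≤ ψ

namespace Parameters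

variable {ψ G d lam : ℝ} (h : Parameters ψ G d lam)
include h

/-- As `ψ ≤ G`, the factor `ψ + G` in `deg_lam_le` is at least `2 ψ`; then cancel `ψ`. This supplies
the smallness required in `IsPerturbation`. -/
lemma mul_le_eighth : G * (d * lam) ≤ 1 / 8 := by
  have hψ := h.psi_pos
  have h1 := h.psi_le
  have h2 := h.deg_lam_le
  have hdl : 0 ≤ d * lam := mul_nonneg (by linarith [h.deg]) h.lam_pos.le
  have hG : 0 ≤ G := by linarith [h.one_le]
  have h3 : 4 * G * (2 * ψ) * (d * lam) ≤ 4 * G * (ψ + G) * (d * lam) := by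
    gcongr; linarith
  have h4 : ψ * (8 * (G * (d * lam))) ≤ ψ * 1 := by linarith
  linarith [le_of_mul_le_mul_left h4 hψ]

lemma four_mul_sq_le : 4 * G ^ 2 * (d * lam) ≤ ψ := by
  have hdl : 0 ≤ d * lam := mul_nonneg (by linarith [h.deg]) h.lam_pos.le
  have hG : 0 ≤ G := by linarith [h.one_le]
  have : 0 ≤ 4 * G * ψ * (d * lam) :=
    mul_nonneg (mul_nonneg (by linarith) h.psi_pos.le) hdl
  linarith [h.deg_lam_le]

lemma four_mul_sq_le' : 4 * G ^ 2 * lam ≤ ψ := by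
  refine le_trans ?_ h.four_mul_sq_le
  refine mul_le_mul_of_nonneg_left ?_ (by positivity)
  linarith [mul_le_mul_of_nonneg_right h.deg h.lam_pos.le]

/-- An irrepresentability condition: the large weight `w` of an inactive entry dominates the bounds
on its coefficients found in `exists_coefficients`. -/
lemma irrepresentable {H w : ℝ} (hH : 0 ≤ H) (hw : 2 * (ψ + 2 * G) * d < w)
    (hHw : H * ψ ≤ lam * G * w) :
    8 / 7 * G * (lam * (1 + H)) + lam * (2 / ψ * H +
      max (2 / ψ) (4 / 3) * (8 / 7 * G * ((d + 1) * lam + d * lam * H))) < lam * w := by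
  have hψ := h.psi_pos
  have hψG := h.psi_le
  have hG := h.one_le
  have hd := h.deg
  have hl := h.lam_pos
  have hG0 : 0 < G := by linarith
  have w1 : 4 * G + 2 * ψ < w := by nlinarith
  have w2 : 6 * ψ * d ≤ w := by nlinarith
  have w0 : 0 < w := by linarith
  have f2 : 4 * (G * H) ≤ w := by
    have h1 := h.four_mul_sq_le'
    have h2 : ψ * (4 * (G * H)) ≤ ψ * w := by
      calc ψ * (4 * (G * H)) = 4 * G * (H * ψ) := by ring
        _ ≤ 4 * G * (lam * G * w) := by gcongr
        _ = 4 * G ^ 2 * lam * w := by ring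
        _ ≤ ψ * w := by gcongr
    exact le_of_mul_le_mul_left h2 hψ
  have f3 : 8 * H ≤ ψ * w := by
    have h2 : ψ * (8 * H) ≤ ψ * (ψ * w) := by
      calc ψ * (8 * H) = 8 * (H * ψ) := by ring
        _ ≤ 8 * (lam * G * w) := by gcongr
        _ = 8 * G * lam * w := by ring
        _ ≤ ψ ^ 2 * w := mul_le_mul_of_nonneg_right h.lam_le w0.le
        _ = ψ * (ψ * w) := by ring
    exact le_of_mul_le_mul_left h2 hψ
  have f3' : 2 / ψ * H ≤ w / 4 := by
    rw [div_mul_eq_mul_div, div_le_iff₀ hψ]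
    linarith
  have f4 := h.mul_le_eighth
  have f1 : G * ((d + 1) * lam) ≤ 2 * (G * (d * lam)) := by
    have : G * ((d + 1) * lam) = G * (d * lam) + G * (1 * lam) := by ring
    have : G * (1 * lam) ≤ G * (d * lam) := by gcongr
    linarith
  have key : max (2 / ψ) (4 / 3) * (G * ((d + 1) * lam)) ≤ w / 12 ∧
      max (2 / ψ) (4 / 3) * (G * (d * lam)) * H ≤ w / 24 := by
    rcases max_choice (2 / ψ) (4 / 3) with e | e <;> rw [e]
    · constructor
      · have h8 := mul_le_mul_of_nonneg_right h.lam_le (show 0 ≤ d by linarith)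
        rw [div_mul_eq_mul_div, div_le_iff₀ hψ]
        nlinarith
      · have : 2 / ψ * (G * (d * lam)) * H = G * (d * lam) * (2 / ψ * H) := by ring
        rw [this]
        have h0 : 0 ≤ 2 / ψ * H := by positivity
        calc G * (d * lam) * (2 / ψ * H) ≤ 1 / 8 * (w / 4) := by gcongr
          _ ≤ w / 24 := by linarith
    · constructor
      · linarith
      · have h9 : G * (d * lam) * H ≤ 1 / 8 * H := mul_le_mul_of_nonneg_right f4 hH
        have h10 : 1 * H ≤ G * H := mul_le_mul_of_nonneg_right hG hH
        linarith
  obtain ⟨k1, k2⟩ := key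
  set W := max (2 / ψ) (4 / 3)
  have e : 8 / 7 * G * (lam * (1 + H)) + lam * (2 / ψ * H +
      W * (8 / 7 * G * ((d + 1) * lam + d * lam * H))) =
      lam * (8 / 7 * (G + G * H + W * (G * ((d + 1) * lam)) + W * (G * (d * lam)) * H) +
        2 / ψ * H) := by ring
  rw [e]
  refine mul_lt_mul_of_pos_left ?_ hl
  -- Shares of `w`: `8/7 · (1/4 + 1/4 + 1/12 + 1/24) + 1/4 = 27/28`.
  linarith

lemma error_lt : 8 / 7 * G * (lam * max (2 / ψ) (4 / 3) + lam * G) < ψ := by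
  have hψ := h.psi_pos
  have hG := h.one_le
  have hl := h.lam_pos
  have f1 := h.four_mul_sq_le'
  have f2 : G * lam ≤ G ^ 2 * lam := by
    refine mul_le_mul_of_nonneg_right ?_ hl.le
    nlinarith
  have key : max (2 / ψ) (4 / 3) * (G * lam) ≤ ψ / 3 := by
    rcases max_choice (2 / ψ) (4 / 3) with e | e <;> rw [e]
    · rw [div_mul_eq_mul_div, div_le_iff₀ hψ]
      nlinarith [h.lam_le]
    · linarith
  set W := max (2 / ψ) (4 / 3)
  have e : 8 / 7 * G * (lam * W + lam * G) = 8 / 7 * (W * (G * lam) + G ^ 2 * lam) := by ring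
  rw [e]
  -- The total is at most `8/7 · (1/3 + 1/4) ψ = 2/3 ψ`.
  linarith

end Parameters

end Perturbation

/-! ### Weighted `ℓ₁` minimization, column by column -/

section Columns

variable {p : ℕ}

/-- The problems CLIME and adaptive CLIME have optimal solutions as soon as they are feasible. -/
lemma exists_isMinOn_weighted (R W L : Matrix (Fin p) (Fin p) ℝ) (hW : ∀ i j, 0 < W i j)
    {V : Matrix (Fin p) (Fin p) ℝ} (hV : ∀ i j, |(R * V - 1) i j| ≤ L i j) :
    ∃ U ∈ {U : Matrix (Fin p) (Fin p) ℝ | ∀ i j, |(R * U - 1) i j| ≤ L i j},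
      IsMinOn (fun U => entryL1 (Matrix.hadamard W U))
        {U : Matrix (Fin p) (Fin p) ℝ | ∀ i j, |(R * U - 1) i j| ≤ L i j} U := by
  set F := {U : Matrix (Fin p) (Fin p) ℝ | ∀ i j, |(R * U - 1) i j| ≤ L i j}
  set f : Matrix (Fin p) (Fin p) ℝ → ℝ := fun U => entryL1 (Matrix.hadamard W U) with hf
  have hfc : Continuous f := by
    simp only [hf, entryL1, Matrix.hadamard_apply]
    fun_prop
  have hFc : IsClosed F := by
    have : F = ⋂ i, ⋂ j, {U : Matrix (Fin p) (Fin p) ℝ | |(R * U - 1) i j| ≤ L i j} := by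
      ext U; simp [F]
    rw [this]
    refine isClosed_iInter fun i => isClosed_iInter fun j => isClosed_le ?_ continuous_const
    have : Continuous fun U : Matrix (Fin p) (Fin p) ℝ => R * U - 1 := by fun_prop
    exact (this.matrix_elem i j).abs
  let box : Set (Matrix (Fin p) (Fin p) ℝ) :=
    Set.univ.pi fun i => Set.univ.pi fun j => Set.Icc (-(f V / W i j)) (f V / W i j)
  have hbox : IsCompact box :=
    isCompact_univ_pi fun i => isCompact_univ_pi fun j => isCompact_Icc
  -- Positive weights make the sublevel sets bounded, so the minimum over this compact set is a
  -- global one.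
  have hK : IsCompact (F ∩ {U | f U ≤ f V}) := by
    refine hbox.of_isClosed_subset (hFc.inter (isClosed_le hfc continuous_const)) ?_
    rintro U ⟨_, hU⟩ i _ j _
    have h1 : |W i j * U i j| ≤ f U := by
      have a1 : |W i j * U i j| ≤ ∑ j, |W i j * U i j| :=
        Finset.single_le_sum (f := fun j => |W i j * U i j|) (fun _ _ => abs_nonneg _)
          (Finset.mem_univ j)
      have a2 : ∑ j, |W i j * U i j| ≤ f U :=
        Finset.single_le_sum (f := fun i => ∑ j, |W i j * U i j|)
          (fun _ _ => Finset.sum_nonneg fun _ _ => abs_nonneg _) (Finset.mem_univ i)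
      exact a1.trans a2
    have h2 : |U i j| ≤ f V / W i j := by
      rw [le_div_iff₀ (hW i j)]
      rw [abs_mul, abs_of_pos (hW i j)] at h1
      have : f U ≤ f V := hU
      linarith
    exact abs_le.1 h2
  obtain ⟨U, ⟨hUF, hUV⟩, hmin⟩ := hK.exists_isMinOn ⟨V, hV, le_refl (f V)⟩ hfc.continuousOn
  refine ⟨U, hUF, fun U' hU' => ?_⟩
  by_cases h : f U' ≤ f V
  · exact hmin ⟨hU', h⟩
  · exact le_trans (show f U ≤ f V from hUV) (not_le.1 h).le

/-- Each column of an optimal solution is optimal for the corresponding column problem. -/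
lemma IsMinOn.column_le {R W L U : Matrix (Fin p) (Fin p) ℝ}
    (hU : ∀ i j, |(R * U - 1) i j| ≤ L i j)
    (hmin : IsMinOn (fun U => entryL1 (Matrix.hadamard W U))
        {U : Matrix (Fin p) (Fin p) ℝ | ∀ i j, |(R * U - 1) i j| ≤ L i j} U)
    (k : Fin p) {θ : Fin p → ℝ}
    (hθ : ∀ i, |R.mulVec θ i - (1 : Matrix (Fin p) (Fin p) ℝ) i k| ≤ L i k) :
    ∑ i, |W i k * U i k| ≤ ∑ i, |W i k * θ i| := by
  have hfeas : U.updateCol k θ ∈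
      {U : Matrix (Fin p) (Fin p) ℝ | ∀ i j, |(R * U - 1) i j| ≤ L i j} := by
    intro i j
    rw [Matrix.sub_apply, Matrix.mul_apply]
    by_cases hj : j = k
    · subst hj
      simp only [Matrix.updateCol_self]
      exact hθ i
    · simp only [Matrix.updateCol_ne hj]
      simpa [Matrix.mul_apply] using hU i j
  have h := hmin hfeas
  simp only [Set.mem_ofPred_eq, entryL1, Matrix.hadamard_apply] at h
  rw [Finset.sum_comm, Finset.sum_comm (f := fun i j => |W i j * U.updateCol k θ i j|),
    ← Finset.add_sum_erase _ _ (Finset.mem_univ k),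
    ← Finset.add_sum_erase _ (fun j => ∑ i, |W i j * U.updateCol k θ i j|)
      (Finset.mem_univ k)] at h
  have e : ∑ j ∈ Finset.univ.erase k, ∑ i, |W i j * U.updateCol k θ i j| =
      ∑ j ∈ Finset.univ.erase k, ∑ i, |W i j * U i j| := by
    refine Finset.sum_congr rfl fun j hj => Finset.sum_congr rfl fun i _ => ?_
    rw [Matrix.updateCol_ne (Finset.ne_of_mem_erase hj)]
  rw [e] at h
  simpa only [Matrix.updateCol_self] using le_of_add_le_add_right h

variable {R : Matrix (Fin p) (Fin p) ℝ} (hR : ∀ i j, R i j = R j i) {T : Finset (Fin p)}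
  {k : Fin p} {w : Fin p → ℝ} {lam : ℝ} {c : Fin p → Fin p → ℝ}
  (hc : ∀ i ∉ T, ∀ j ∈ T, ∑ l ∈ T, R j l * c i l = R i j)
include hR hc

/-- On vectors supported on `T`, row `i` of `R` acts as the combination of the rows in `T` with
coefficients `c i`. -/
lemma mulVec_eq_of_support {θ : Fin p → ℝ} (hθ : ∀ i ∉ T, θ i = 0) {i : Fin p} (hi : i ∉ T) :
    R.mulVec θ i = ∑ j ∈ T, c i j * R.mulVec θ j := by
  have hsup : ∀ j, R.mulVec θ j = ∑ l ∈ T, R j l * θ l := by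
    intro j
    rw [Matrix.mulVec, dotProduct]
    refine (Finset.sum_subset (Finset.subset_univ T) fun l _ hl => ?_).symm
    rw [hθ l hl, mul_zero]
  simp only [hsup]
  calc ∑ l ∈ T, R i l * θ l = ∑ l ∈ T, ∑ j ∈ T, R l j * c i j * θ l := by
        refine Finset.sum_congr rfl fun l hl => ?_
        rw [← hc i hi l hl, Finset.sum_mul]
    _ = ∑ j ∈ T, c i j * ∑ l ∈ T, R j l * θ l := by
        rw [Finset.sum_comm]
        refine Finset.sum_congr rfl fun j _ => ?_
        rw [Finset.mul_sum]
        refine Finset.sum_congr rfl fun l _ => ?_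
        rw [hR l j]
        ring

variable (hk : k ∈ T)
  (hreq : ∀ i ∉ T, |c i k| + lam * ∑ j ∈ T, |c i j| * w j < lam * w i)
include hk hreq

/-- A vector supported on `T` which satisfies the constraints on `T` satisfies all constraints. -/
lemma feasible_of_support {θ : Fin p → ℝ} (hθ : ∀ i ∉ T, θ i = 0)
    (hf : ∀ j ∈ T, |R.mulVec θ j - (1 : Matrix (Fin p) (Fin p) ℝ) j k| ≤ lam * w j) (i : Fin p) :
    |R.mulVec θ i - (1 : Matrix (Fin p) (Fin p) ℝ) i k| ≤ lam * w i := by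
  by_cases hi : i ∈ T
  · exact hf i hi
  have hik : i ≠ k := fun h => hi (h ▸ hk)
  rw [Matrix.one_apply_ne hik, sub_zero, mulVec_eq_of_support hR hc hθ hi]
  -- The unit vector in the constraints on `T` contributes exactly `c i k`; this is why `c i k`
  -- enters `hreq` without a factor `lam`.
  have e : ∑ j ∈ T, c i j * R.mulVec θ j =
      c i k + ∑ j ∈ T, c i j * (R.mulVec θ j - (1 : Matrix (Fin p) (Fin p) ℝ) j k) := by
    simp only [mul_sub, Finset.sum_sub_distrib, Matrix.one_apply]
    simp [hk]
  rw [e]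
  refine le_trans ?_ (hreq i hi).le
  refine (abs_add_le _ _).trans (add_le_add le_rfl ?_)
  refine (Finset.abs_sum_le_sum_abs _ _).trans ?_
  rw [Finset.mul_sum]
  refine Finset.sum_le_sum fun j hj => ?_
  rw [abs_mul]
  calc _ ≤ |c i j| * (lam * w j) := mul_le_mul_of_nonneg_left (hf j hj) (abs_nonneg _)
    _ = _ := by ring

/-- The optimal solutions of the column problem are supported on `T`. -/
lemma support_of_optimal (hlam : 0 < lam) (hw : ∀ i, 0 ≤ w i) {θ : Fin p → ℝ}
    (hf : ∀ i, |R.mulVec θ i - (1 : Matrix (Fin p) (Fin p) ℝ) i k| ≤ lam * w i)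
    (hmin : ∀ θ' : Fin p → ℝ,
      (∀ i, |R.mulVec θ' i - (1 : Matrix (Fin p) (Fin p) ℝ) i k| ≤ lam * w i) →
      ∑ i, |w i * θ i| ≤ ∑ i, |w i * θ' i|) :
    ∀ i ∉ T, θ i = 0 := by
  classical
  -- The competitor: the mass outside `T` is moved onto `T` so that `R θ` does not change on `T`.
  set θ' : Fin p → ℝ := fun j => if j ∈ T then θ j + ∑ i ∈ Tᶜ, θ i * c i j else 0 with hθ'
  have hsupp : ∀ i ∉ T, θ' i = 0 := fun i hi => by simp [hθ', hi]
  have heq : ∀ j ∈ T, R.mulVec θ' j = R.mulVec θ j := by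
    intro j hj
    rw [Matrix.mulVec, Matrix.mulVec, dotProduct, dotProduct,
      ← Finset.sum_add_sum_compl T, ← Finset.sum_add_sum_compl T]
    have e1 : ∑ l ∈ Tᶜ, R j l * θ' l = 0 := Finset.sum_eq_zero fun l hl => by
      rw [hsupp l (Finset.mem_compl.1 hl), mul_zero]
    have e2 : ∑ l ∈ T, R j l * θ' l = ∑ l ∈ T, R j l * θ l +
        ∑ l ∈ T, R j l * ∑ i ∈ Tᶜ, θ i * c i l := by
      rw [← Finset.sum_add_distrib]
      refine Finset.sum_congr rfl fun l hl => ?_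
      simp only [hθ', if_pos hl, mul_add]
    rw [e1, add_zero, e2]
    congr 1
    simp only [Finset.mul_sum]
    rw [Finset.sum_comm]
    refine Finset.sum_congr rfl fun i hi => ?_
    rw [hR j i, ← hc i (Finset.mem_compl.1 hi) j hj, Finset.sum_mul]
    exact Finset.sum_congr rfl fun l _ => by ring
  have hfeas := feasible_of_support hR hc hk hreq hsupp fun j hj => by
    rw [heq j hj]; exact hf j
  have hle := hmin θ' hfeas
  rw [← Finset.sum_add_sum_compl T, ← Finset.sum_add_sum_compl T fun i => |w i * θ' i|] at hle
  have e1 : ∑ l ∈ Tᶜ, |w l * θ' l| = 0 := Finset.sum_eq_zero fun l hl => by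
    rw [hsupp l (Finset.mem_compl.1 hl), mul_zero, abs_zero]
  have e2 : ∑ l ∈ T, |w l * θ' l| ≤ ∑ l ∈ T, |w l * θ l| +
      ∑ i ∈ Tᶜ, |θ i| * ∑ l ∈ T, |c i l| * w l := by
    have : ∑ i ∈ Tᶜ, |θ i| * ∑ l ∈ T, |c i l| * w l =
        ∑ l ∈ T, w l * ∑ i ∈ Tᶜ, |θ i * c i l| := by
      simp only [Finset.mul_sum]
      rw [Finset.sum_comm]
      refine Finset.sum_congr rfl fun l _ => Finset.sum_congr rfl fun i _ => ?_
      rw [abs_mul]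
      ring
    rw [this, ← Finset.sum_add_distrib]
    refine Finset.sum_le_sum fun l hl => ?_
    simp only [hθ', if_pos hl, abs_mul, abs_of_nonneg (hw l)]
    rw [← mul_add]
    refine mul_le_mul_of_nonneg_left ?_ (hw l)
    refine (abs_add_le _ _).trans (add_le_add le_rfl ?_)
    simpa only [abs_mul] using Finset.abs_sum_le_sum_abs (fun i => θ i * c i l) Tᶜ
  have hlt : ∀ i ∉ T, ∑ l ∈ T, |c i l| * w l < w i := by
    intro i hi
    have := hreq i hi
    exact lt_of_mul_lt_mul_left (lt_of_le_of_lt (le_add_of_nonneg_left (abs_nonneg _)) this) hlam.le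
  have hz : ∑ i ∈ Tᶜ, |θ i| * (w i - ∑ l ∈ T, |c i l| * w l) ≤ 0 := by
    simp only [mul_sub, Finset.sum_sub_distrib]
    have : ∑ i ∈ Tᶜ, |w i * θ i| = ∑ i ∈ Tᶜ, |θ i| * w i :=
      Finset.sum_congr rfl fun i _ => by rw [abs_mul, abs_of_nonneg (hw i), mul_comm]
    linarith
  have hnn : ∀ i ∈ Tᶜ, 0 ≤ |θ i| * (w i - ∑ l ∈ T, |c i l| * w l) := fun i hi =>
    mul_nonneg (abs_nonneg _) (sub_nonneg.2 (hlt i (Finset.mem_compl.1 hi)).le)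
  intro i hi
  have h0 := (Finset.sum_eq_zero_iff_of_nonneg hnn).1 (le_antisymm hz (Finset.sum_nonneg hnn)) i
    (Finset.mem_compl.2 hi)
  rcases mul_eq_zero.1 h0 with h | h
  · exact abs_eq_zero.1 h
  · exact absurd h (sub_pos.2 (hlt i hi)).ne'

end Columns

/-! ### Population quantities -/

section Population

variable {p : ℕ} {κ ν : Type*} [Fintype κ] [Fintype ν]

lemma sum_abs_le_matL1 (A : Matrix κ ν ℝ) (j : ν) : ∑ i, |A i j| ≤ matL1 A :=
  le_ciSup (f := fun j => ∑ i, |A i j|) (Set.finite_range _).bddAbove j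

lemma sum_abs_le_matLinf (A : Matrix κ ν ℝ) (i : κ) : ∑ j, |A i j| ≤ matLinf A :=
  le_ciSup (f := fun i => ∑ j, |A i j|) (Set.finite_range _).bddAbove i

lemma matLinf_nonneg (A : Matrix κ ν ℝ) : 0 ≤ matLinf A :=
  Real.iSup_nonneg fun _ => Finset.sum_nonneg fun _ _ => abs_nonneg _

lemma psiMin_le {Th : Matrix (Fin p) (Fin p) ℝ} {i j : Fin p} (hij : i ≠ j) (h : Th i j ≠ 0) :
    psiMin Th ≤ |Th i j| :=
  csInf_le ((Set.toFinite _).bddBelow) ⟨(i, j), ⟨hij, h⟩, rfl⟩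

lemma psiMin_pos {Th : Matrix (Fin p) (Fin p) ℝ} (h : (support Th).Nonempty) : 0 < psiMin Th := by
  obtain ⟨q, hq, he⟩ := (h.image fun q : Fin p × Fin p => |Th q.1 q.2|).csInf_mem (Set.toFinite _)
  rw [psiMin, ← he]
  exact abs_pos.2 hq.2

lemma mem_active {Th : Matrix (Fin p) (Fin p) ℝ} {k j : Fin p} :
    j ∈ active Th k ↔ j ≠ k ∧ Th k j ≠ 0 := by
  simp [active]

lemma self_notMem_active (Th : Matrix (Fin p) (Fin p) ℝ) (k : Fin p) : k ∉ active Th k := by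
  simp [mem_active]

lemma self_mem_activeT (Th : Matrix (Fin p) (Fin p) ℝ) (k : Fin p) : k ∈ activeT Th k :=
  Finset.mem_insert_self _ _

lemma card_activeT (Th : Matrix (Fin p) (Fin p) ℝ) (k : Fin p) :
    (activeT Th k).card = (active Th k).card + 1 :=
  Finset.card_insert_of_notMem (self_notMem_active Th k)

lemma card_active_le (Th : Matrix (Fin p) (Fin p) ℝ) (k : Fin p) :
    (active Th k).card ≤ maxDeg Th :=
  Finset.le_sup (f := fun k => (active Th k).card) (Finset.mem_univ k)

lemma one_le_maxDeg {Th : Matrix (Fin p) (Fin p) ℝ} (h : (support Th).Nonempty) :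
    1 ≤ maxDeg Th := by
  obtain ⟨⟨i, j⟩, hij, h0⟩ := h
  exact (Finset.card_pos.2 ⟨j, mem_active.2 ⟨Ne.symm hij, h0⟩⟩).trans_le (card_active_le Th i)

lemma mul_inv_eq_one [DecidableEq κ] {A : Matrix κ κ ℝ} (hA : A.PosDef) : A * A⁻¹ = 1 :=
  Matrix.mul_nonsing_inv A ((Matrix.isUnit_iff_isUnit_det A).1 hA.isUnit)

lemma inv_mul_eq_one [DecidableEq κ] {A : Matrix κ κ ℝ} (hA : A.PosDef) : A⁻¹ * A = 1 :=
  Matrix.nonsing_inv_mul A ((Matrix.isUnit_iff_isUnit_det A).1 hA.isUnit)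

variable {S : Matrix (Fin p) (Fin p) ℝ} (hS : S.PosDef)
include hS

lemma symm_apply (i j : Fin p) : S i j = S j i := by
  simpa using hS.1.apply j i

lemma inv_symm (i j : Fin p) : S⁻¹ i j = S⁻¹ j i := symm_apply hS.inv i j

lemma inv_eq_zero_of_notMem_activeT {k i : Fin p} (hi : i ∉ activeT S⁻¹ k) : S⁻¹ i k = 0 := by
  by_contra h
  rw [inv_symm hS] at h
  refine hi ?_
  by_cases hik : i = k
  · rw [hik]; exact self_mem_activeT _ _
  · exact Finset.mem_insert_of_mem (mem_active.2 ⟨hik, h⟩)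

lemma sum_activeT_mul_inv (k i : Fin p) :
    ∑ l ∈ activeT S⁻¹ k, S i l * S⁻¹ l k = (1 : Matrix (Fin p) (Fin p) ℝ) i k := by
  rw [← mul_inv_eq_one hS, Matrix.mul_apply]
  refine Finset.sum_subset (Finset.subset_univ _) fun l _ hl => ?_
  rw [inv_eq_zero_of_notMem_activeT hS hl, mul_zero]

/-- The quadratic form of `S` at `e_k - S⁻¹ e_k` equals `S k k - 2 + S⁻¹ k k`. -/
lemma one_le_inv_diag (hdiag : ∀ j, S j j = 1) (k : Fin p) : 1 ≤ S⁻¹ k k := by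
  have h := hS.posSemidef.dotProduct_mulVec_nonneg (Pi.single k 1 - S⁻¹.col k)
  have e : S.mulVec (Pi.single k 1 - S⁻¹.col k) = S.col k - Pi.single k 1 := by
    rw [Matrix.mulVec_sub, Matrix.mulVec_single_one, ← Matrix.mulVec_single_one S⁻¹,
      Matrix.mulVec_mulVec, mul_inv_eq_one hS, Matrix.one_mulVec]
  have e2 : S⁻¹.col k ⬝ᵥ S.col k = 1 := by
    have := congrFun (congrFun (inv_mul_eq_one hS) k) k
    rw [Matrix.mul_apply, Matrix.one_apply_eq] at this
    rw [← this, dotProduct]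
    exact Finset.sum_congr rfl fun l _ => by rw [Matrix.col_apply, Matrix.col_apply, inv_symm hS]
  rw [e, star_trivial, sub_dotProduct, dotProduct_sub, dotProduct_sub, e2] at h
  simp [hdiag] at h
  linarith

lemma posDef_subMat (T : Finset (Fin p)) : (subMat S T T).PosDef :=
  hS.submatrix Subtype.val_injective

/-- Column `k` of `S⁻¹` vanishes off the active set, so restricting `S S⁻¹ e_k = e_k` to the block
loses nothing. Thus `Gt` controls the true column. -/
lemma inv_subMat_apply (k : Fin p) (j : activeT S⁻¹ k) :
    (subMat S (activeT S⁻¹ k) (activeT S⁻¹ k))⁻¹ j ⟨k, self_mem_activeT _ _⟩ = S⁻¹ j k := by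
  have hP := posDef_subMat hS (activeT S⁻¹ k)
  have e : (subMat S (activeT S⁻¹ k) (activeT S⁻¹ k)).mulVec (fun l => S⁻¹ l k) =
      Pi.single ⟨k, self_mem_activeT _ _⟩ 1 := by
    funext i
    rw [Matrix.mulVec, dotProduct]
    have := sum_activeT_mul_inv hS k i
    rw [← Finset.sum_coe_sort] at this
    refine this.trans ?_
    simp [Matrix.one_apply, Pi.single_apply, Subtype.ext_iff]
  have e2 := congrArg (fun x => (subMat S (activeT S⁻¹ k) (activeT S⁻¹ k))⁻¹.mulVec x j) e
  simp only [Matrix.mulVec_mulVec, inv_mul_eq_one hP, Matrix.one_mulVec,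
    Matrix.mulVec_single_one] at e2
  exact e2.symm

end Population

/-! ### Consistency of the adaptive CLIME on the event that `R` is close to `S` -/

section Deterministic

variable {p : ℕ} {S R : Matrix (Fin p) (Fin p) ℝ} (hS : S.PosDef) (hdiag : ∀ j, S j j = 1)
  (hR : ∀ i j, R i j = R j i) (hRd : ∀ i, R i i = 1)

include hS in
lemma inv_subMat_symm (T : Finset (Fin p)) (i j : T) :
    (subMat S T T)⁻¹ i j = (subMat S T T)⁻¹ j i := by
  simpa using (posDef_subMat hS T).inv.1.apply j i

include hS in
lemma abs_inv_le_Gt (k j : Fin p) : |S⁻¹ j k| ≤ Gt S k := by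
  by_cases hj : j ∈ activeT S⁻¹ k
  · rw [← inv_subMat_apply hS k ⟨j, hj⟩]
    exact (Finset.single_le_sum (f := fun l => |(subMat S (activeT S⁻¹ k) (activeT S⁻¹ k))⁻¹
      ⟨j, hj⟩ l|) (fun _ _ => abs_nonneg _) (Finset.mem_univ _)).trans (sum_abs_le_matLinf _ _)
  · rw [inv_eq_zero_of_notMem_activeT hS hj, abs_zero]
    exact matLinf_nonneg _

include hS hdiag in
lemma one_le_Gt (k : Fin p) : 1 ≤ Gt S k :=
  (one_le_inv_diag hS hdiag k).trans ((le_abs_self _).trans (abs_inv_le_Gt hS k k))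

include hS hdiag in
lemma one_le_matL1_inv (k : Fin p) : 1 ≤ matL1 S⁻¹ :=
  (one_le_inv_diag hS hdiag k).trans ((le_abs_self _).trans
    ((Finset.single_le_sum (f := fun i => |S⁻¹ i k|) (fun _ _ => abs_nonneg _)
      (Finset.mem_univ _)).trans (sum_abs_le_matL1 _ _)))

include hS in
lemma psiMin_le_Gt {k : Fin p} (h : (active S⁻¹ k).Nonempty) : psiMin S⁻¹ ≤ Gt S k := by
  obtain ⟨j, hj⟩ := h
  obtain ⟨hjk, h0⟩ := mem_active.1 hj
  refine (psiMin_le hjk.symm h0).trans ?_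
  rw [inv_symm hS]
  exact abs_inv_le_Gt hS k j

include hS in
lemma sum_activeT_abs_inv_le (k : Fin p) : ∑ l ∈ activeT S⁻¹ k, |S⁻¹ l k| ≤ Gt S k := by
  rw [← Finset.sum_coe_sort]
  simp only [← inv_subMat_apply hS k]
  simp only [fun l => inv_subMat_symm hS (activeT S⁻¹ k) l ⟨k, self_mem_activeT _ _⟩]
  exact sum_abs_le_matLinf _ _

include hS hdiag hR hRd in
lemma isPerturbation_subMat {δ : ℝ} (hclose : ∀ i j, |R i j - S i j| ≤ δ) (k : Fin p)
    (hη : Gt S k * ((active S⁻¹ k).card * δ) ≤ 1 / 8) :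
    IsPerturbation (subMat S (activeT S⁻¹ k) (activeT S⁻¹ k))⁻¹
      (subMat S (activeT S⁻¹ k) (activeT S⁻¹ k)) (subMat R (activeT S⁻¹ k) (activeT S⁻¹ k))
      (Gt S k) ((active S⁻¹ k).card * δ) := by
  classical
  have hrow : ∀ i : activeT S⁻¹ k, ∑ j, |(subMat R (activeT S⁻¹ k) (activeT S⁻¹ k) -
      subMat S (activeT S⁻¹ k) (activeT S⁻¹ k)) i j| ≤ (active S⁻¹ k).card * δ := by
    intro i
    rw [← Finset.add_sum_erase _ _ (Finset.mem_univ i)]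
    -- Both diagonals are one, so a row has only as many nonzero errors as `k` has neighbours, one
    -- fewer than the size of the block.
    have h0 : |(subMat R (activeT S⁻¹ k) (activeT S⁻¹ k) -
      subMat S (activeT S⁻¹ k) (activeT S⁻¹ k)) i i| = 0 := by
      simp [subMat, hRd, hdiag]
    rw [h0, zero_add]
    have hcard : ((Finset.univ.erase i).card : ℝ) = (active S⁻¹ k).card := by
      rw [Finset.card_erase_of_mem (Finset.mem_univ i), Finset.card_univ, Fintype.card_coe,
        card_activeT, Nat.add_sub_cancel]
    rw [← hcard, ← nsmul_eq_mul]
    exact Finset.sum_le_card_nsmul _ _ _ fun j _ => hclose i j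
  refine ⟨inv_mul_eq_one (posDef_subMat hS _), sum_abs_le_matLinf _, fun j => ?_, hrow, fun j => ?_,
    matLinf_nonneg _, hη, ?_⟩
  · simp only [fun i => inv_subMat_symm hS (activeT S⁻¹ k) i j]
    exact sum_abs_le_matLinf _ _
  · refine le_trans (le_of_eq ?_) (hrow j)
    refine Finset.sum_congr rfl fun i _ => ?_
    simp only [subMat, Matrix.sub_apply, Matrix.submatrix_apply]
    rw [hR, symm_apply hS]
  · ext i j
    exact hR _ _

include hS hdiag hR hRd in
/-- The dual certificate for an inactive row `i`: its coefficients with respect to the active rows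
are small. -/
lemma exists_coefficients {lam d : ℝ} (hclose : ∀ i j, |R i j - S i j| ≤ lam) {k i : Fin p}
    (hi : i ∉ activeT S⁻¹ k)
    (hpar : (active S⁻¹ k).Nonempty → Parameters (psiMin S⁻¹) (Gt S k) d lam)
    (hcard : (active S⁻¹ k).card ≤ d) {w : Fin p → ℝ} (hw : ∀ j, 0 ≤ w j)
    (hwA : ∀ j ∈ active S⁻¹ k, w j ≤ 2 / psiMin S⁻¹) (hwk : w k ≤ 4 / 3) (hw4 : 4 < w i)
    (hwi : 2 * (psiMin S⁻¹ + 2 * Gt S k) * d < w i)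
    (hH : Ht S k * psiMin S⁻¹ ≤ lam * Gt S k * w i) (hlam : 0 < lam) (hlam1 : lam ≤ 1) :
    ∃ c : Fin p → ℝ, (∀ j ∈ activeT S⁻¹ k, ∑ l ∈ activeT S⁻¹ k, R j l * c l = R i j) ∧
      |c k| + lam * ∑ j ∈ activeT S⁻¹ k, |c j| * w j < lam * w i := by
  classical
  by_cases hne : (active S⁻¹ k).Nonempty
  · have hp := hpar hne
    have hd0 : 0 ≤ d := by linarith [hp.deg]
    have hη : Gt S k * ((active S⁻¹ k).card * lam) ≤ 1 / 8 := by
      refine le_trans ?_ hp.mul_le_eighth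
      have := matLinf_nonneg (subMat S (activeT S⁻¹ k) (activeT S⁻¹ k))⁻¹
      exact mul_le_mul_of_nonneg_left (mul_le_mul_of_nonneg_right hcard hlam.le) this
    have hP := isPerturbation_subMat hS hdiag hR hRd hclose k hη
    set T := activeT S⁻¹ k with hT
    obtain ⟨c, hc⟩ := hP.exists_mulVec_eq fun j : T => R i j
    set b : T → ℝ := (subMat S T T)⁻¹.mulVec fun j : T => S i j with hb
    have hbS : (subMat S T T).mulVec b = fun j : T => S i j := by
      rw [hb, Matrix.mulVec_mulVec, mul_inv_eq_one (posDef_subMat hS T), Matrix.one_mulVec]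
    have hbH : ∑ j, |b j| ≤ Ht S k := by
      have := sum_abs_le_matLinf (subMat S Tᶜ T * (subMat S T T)⁻¹) ⟨i, Finset.mem_compl.2 hi⟩
      refine le_trans (le_of_eq ?_) this
      refine Finset.sum_congr rfl fun j _ => ?_
      rw [hb, Matrix.mulVec, dotProduct, Matrix.mul_apply]
      congr 1
      refine Finset.sum_congr rfl fun l _ => ?_
      rw [inv_subMat_symm hS T j l, mul_comm]
      rfl
    let k' : T := ⟨k, self_mem_activeT _ _⟩
    -- The population coefficient at `k` is the entry `(i, k)` of `S * S⁻¹`. Hence `c k` consists of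
    -- perturbation error alone and is of order `lam`.
    have hbk : b k' = 0 := by
      have h1 := sum_activeT_mul_inv hS k i
      rw [Matrix.one_apply_ne (show i ≠ k from fun h => hi (h.symm ▸ self_mem_activeT _ _)), ← hT,
        ← Finset.sum_coe_sort] at h1
      rw [← h1, hb, Matrix.mulVec, dotProduct]
      refine Finset.sum_congr rfl fun l _ => ?_
      rw [inv_subMat_symm hS T k' l, inv_subMat_apply hS k l, mul_comm]
    obtain ⟨h1, h2⟩ := hP.sub_le hc hbS hbH (fun j => hclose i j) (fun i j => hclose i j) k'
    rw [hbk, sub_zero] at h1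
    have hH0 : 0 ≤ Ht S k := matLinf_nonneg _
    have hψ := hp.psi_pos
    set W := max (2 / psiMin S⁻¹) (4 / 3) with hW
    have hwW : ∀ j : T, w j ≤ W := by
      rintro ⟨j, hj⟩
      rcases Finset.mem_insert.1 hj with rfl | hj
      · exact hwk.trans (le_max_right _ _)
      · exact (hwA j hj).trans (le_max_left _ _)
    have hsum : ∑ j : T, |c j| * w j ≤ 2 / psiMin S⁻¹ * Ht S k +
        W * (8 / 7 * Gt S k * ((d + 1) * lam + d * lam * Ht S k)) := by
      have h3 : ∀ j : T, |c j| * w j ≤ 2 / psiMin S⁻¹ * |b j| + W * |c j - b j| := by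
        intro j
        have e1 : |c j| ≤ |b j| + |c j - b j| := by
          have := abs_add_le (b j) (c j - b j)
          rwa [add_sub_cancel] at this
        have e2 : |b j| * w j ≤ 2 / psiMin S⁻¹ * |b j| := by
          by_cases hjk : j = k'
          · rw [hjk, hbk]; simp
          · rw [mul_comm]
            refine mul_le_mul_of_nonneg_right (hwA j ?_) (abs_nonneg _)
            rcases Finset.mem_insert.1 j.2 with h | h
            · exact absurd (Subtype.ext h) hjk
            · exact h
        have e3 : |c j - b j| * w j ≤ W * |c j - b j| := by
          rw [mul_comm]
          exact mul_le_mul_of_nonneg_right (hwW j) (abs_nonneg _)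
        have e4 := mul_le_mul_of_nonneg_right e1 (hw j)
        linarith
      refine (Finset.sum_le_sum fun j _ => h3 j).trans ?_
      rw [Finset.sum_add_distrib, ← Finset.mul_sum, ← Finset.mul_sum]
      have hW0 : 0 ≤ W := (by norm_num : (0 : ℝ) ≤ 4 / 3).trans (le_max_right _ _)
      refine add_le_add (mul_le_mul_of_nonneg_left hbH (by positivity))
        (mul_le_mul_of_nonneg_left (h2.trans ?_) hW0)
      refine mul_le_mul_of_nonneg_left ?_ (by linarith [hp.one_le])
      have hcT : (Fintype.card T : ℝ) ≤ d + 1 := by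
        rw [Fintype.card_coe, hT, card_activeT]
        push_cast
        linarith
      exact add_le_add (mul_le_mul_of_nonneg_right hcT hlam.le)
        (mul_le_mul_of_nonneg_right (mul_le_mul_of_nonneg_right hcard hlam.le) hH0)
    refine ⟨fun l => if h : l ∈ T then c ⟨l, h⟩ else 0, fun j hj => ?_, ?_⟩
    · rw [← Finset.sum_coe_sort]
      have := congrFun hc ⟨j, hj⟩
      rw [Matrix.mulVec, dotProduct] at this
      simpa [subMat] using this
    · rw [← Finset.sum_coe_sort]
      have hkT : k ∈ T := self_mem_activeT _ _
      have e : ∀ j : T, (if h : (j : Fin p) ∈ T then c ⟨j, h⟩ else 0) = c j := fun j =>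
        dif_pos j.2
      simp only [e, dif_pos hkT]
      have h4 := hp.irrepresentable hH0 hwi hH
      have h5 := mul_le_mul_of_nonneg_left hsum hlam.le
      linarith [h1]
  -- An isolated variable needs its own argument, since `ψ ≤ Gt S k` relies on an edge at `k`. Here
  -- the system is scalar and `c = R i k` is at most `lam`.
  · rw [Finset.not_nonempty_iff_eq_empty] at hne
    have hT : activeT S⁻¹ k = {k} := by rw [activeT, hne]; rfl
    have hik : i ≠ k := fun h => hi (h ▸ self_mem_activeT _ _)
    have hSik : S i k = 0 := by
      have h1 := sum_activeT_mul_inv hS k i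
      rw [hT, Finset.sum_singleton, Matrix.one_apply_ne hik] at h1
      refine (mul_eq_zero.1 h1).resolve_right ?_
      linarith [one_le_inv_diag hS hdiag k]
    have hRik : |R i k| ≤ lam := by simpa [hSik] using hclose i k
    refine ⟨fun _ => R i k, ?_, ?_⟩
    · intro j hj
      rw [hT, Finset.mem_singleton] at hj
      rw [hT, Finset.sum_singleton, hj, hRd, one_mul]
    · rw [hT, Finset.sum_singleton]
      have h1 : |R i k| * w k ≤ 1 * (4 / 3) :=
        mul_le_mul (hRik.trans hlam1) hwk (hw k) zero_le_one
      have h2 := mul_le_mul_of_nonneg_left h1 hlam.le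
      have h3 := mul_lt_mul_of_pos_left hw4 hlam
      linarith

include hS in
lemma inv_feasible {lamC : ℝ} (hM : 0 < matL1 S⁻¹)
    (hclose : ∀ i j, |R i j - S i j| ≤ lamC / matL1 S⁻¹) (i j : Fin p) :
    |(R * S⁻¹ - 1) i j| ≤ lamC := by
  have e : (R * S⁻¹ - 1) i j = ∑ l, S⁻¹ l j * (R i l - S i l) := by
    rw [← mul_inv_eq_one hS]
    simp only [Matrix.sub_apply, Matrix.mul_apply, ← Finset.sum_sub_distrib]
    exact Finset.sum_congr rfl fun l _ => by ring
  rw [e]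
  refine (abs_sum_mul_le ((abs_nonneg _).trans (hclose i j)) (sum_abs_le_matL1 _ _)
    fun l => hclose i l).trans_eq ?_
  rw [mul_div_cancel₀ _ hM.ne']

include hS in
/-- The CLIME is close to the true precision matrix in the maximum norm. -/
lemma IsClime.abs_sub_le {lamC : ℝ} (hM : 0 < matL1 S⁻¹)
    (hclose : ∀ i j, |R i j - S i j| ≤ lamC / matL1 S⁻¹)
    {U : Matrix (Fin p) (Fin p) ℝ} (hU : IsClime R lamC U) (i j : Fin p) :
    |U i j - S⁻¹ i j| ≤ 2 * matL1 S⁻¹ * lamC := by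
  set M := matL1 S⁻¹ with hMd
  have hl : 0 ≤ lamC / M := (abs_nonneg _).trans (hclose i j)
  have hfeasS := inv_feasible hS hM hclose
  -- Compare column `j` of the CLIME with the feasible column `j` of `S⁻¹`.
  have hcol : ∀ j, ∑ i, |U i j| ≤ M := by
    intro j
    have hU2 : IsMinOn (fun U => entryL1 (Matrix.hadamard (Matrix.of fun _ _ => (1 : ℝ)) U))
        {U : Matrix (Fin p) (Fin p) ℝ | ∀ i j, |(R * U - 1) i j| ≤
          (Matrix.of fun _ _ => lamC : Matrix (Fin p) (Fin p) ℝ) i j} U := by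
      have e : ∀ U : Matrix (Fin p) (Fin p) ℝ,
          Matrix.hadamard (Matrix.of fun _ _ => (1 : ℝ)) U = U := by
        intro U; ext i j; simp [Matrix.hadamard]
      simpa only [e, Matrix.of_apply] using hU.2
    have := IsMinOn.column_le (L := Matrix.of fun _ _ => lamC) hU.1 hU2 j (θ := S⁻¹.col j)
      fun i => hfeasS i j
    simp only [Matrix.of_apply, one_mul, Matrix.col_apply] at this
    exact this.trans (sum_abs_le_matL1 _ _)
  have hres : ∀ l, |(S * U - 1) l j| ≤ 2 * lamC := by
    intro l
    have e : (S * U - 1) l j = (R * U - 1) l j - ∑ m, U m j * (R l m - S l m) := by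
      simp only [Matrix.sub_apply, Matrix.mul_apply, mul_sub, Finset.sum_sub_distrib]
      simp only [mul_comm (U _ j)]
      ring
    rw [e]
    have h1 : |∑ m, U m j * (R l m - S l m)| ≤ M * (lamC / M) :=
      abs_sum_mul_le hl (hcol j) fun m => hclose l m
    rw [mul_div_cancel₀ _ hM.ne'] at h1
    have h2 : |(R * U - 1) l j| ≤ lamC := hU.1 l j
    exact (abs_sub _ _).trans (by linarith)
  have e : U i j - S⁻¹ i j = ∑ l, S⁻¹ i l * (S * U - 1) l j := by
    rw [← Matrix.mul_apply, Matrix.mul_sub, ← Matrix.mul_assoc, inv_mul_eq_one hS, one_mul, mul_one,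
      Matrix.sub_apply]
  rw [e]
  have hrow : ∑ l, |S⁻¹ i l| ≤ M := by
    simp only [fun l => inv_symm hS i l]
    exact sum_abs_le_matL1 _ _
  refine (abs_sum_mul_le ((abs_nonneg _).trans (hres i)) hrow hres).trans_eq (by ring)

end Deterministic

section Consistency

lemma sign_eq_of_abs_sub_lt {x y : ℝ} (h : |x - y| < |y|) :
    SignType.sign x = SignType.sign y := by
  rcases lt_trichotomy y 0 with hy | hy | hy
  · rw [abs_of_neg hy, abs_lt] at h
    rw [sign_neg hy, sign_neg (by linarith)]
  · subst hy
    simp at h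
    exact absurd h (abs_nonneg x).not_gt
  · rw [abs_of_pos hy, abs_lt] at h
    rw [sign_pos hy, sign_pos (by linarith)]

variable {p : ℕ} {S R : Matrix (Fin p) (Fin p) ℝ} (hS : S.PosDef) (hdiag : ∀ j, S j j = 1)
  (hR : ∀ i j, R i j = R j i) (hRd : ∀ i, R i i = 1)

include hS hdiag hR hRd

/-- A vector supported on the active set which satisfies the constraints is close to the column of
the true precision matrix. -/
lemma abs_sub_inv_lt {lam d : ℝ} (hclose : ∀ i j, |R i j - S i j| ≤ lam) {k : Fin p}
    (hp : Parameters (psiMin S⁻¹) (Gt S k) d lam)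
    (hcard : (active S⁻¹ k).card ≤ d) {w : Fin p → ℝ}
    (hwA : ∀ j ∈ active S⁻¹ k, w j ≤ 2 / psiMin S⁻¹) (hwk : w k ≤ 4 / 3)
    {θ : Fin p → ℝ} (hsupp : ∀ i ∉ activeT S⁻¹ k, θ i = 0)
    (hf : ∀ i, |R.mulVec θ i - (1 : Matrix (Fin p) (Fin p) ℝ) i k| ≤ lam * w i)
    {i : Fin p} (hi : i ∈ activeT S⁻¹ k) : |θ i - S⁻¹ i k| < psiMin S⁻¹ := by
  have hlam := hp.lam_pos
  have hG0 : 0 ≤ Gt S k := by linarith [hp.one_le]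
  have hη : Gt S k * ((active S⁻¹ k).card * lam) ≤ 1 / 8 :=
    le_trans (mul_le_mul_of_nonneg_left (mul_le_mul_of_nonneg_right hcard hlam.le) hG0)
      hp.mul_le_eighth
  have hP := isPerturbation_subMat hS hdiag hR hRd hclose k hη
  refine lt_of_le_of_lt ?_ hp.error_lt
  refine hP.abs_le (x := fun j => θ j - S⁻¹ j k) (fun j => ?_) ⟨i, hi⟩
  have e1 : R.mulVec θ j = ∑ l ∈ activeT S⁻¹ k, R j l * θ l := by
    rw [Matrix.mulVec, dotProduct]
    refine (Finset.sum_subset (Finset.subset_univ _) fun l _ hl => ?_).symm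
    rw [hsupp l hl, mul_zero]
  have e2 : (subMat R (activeT S⁻¹ k) (activeT S⁻¹ k)).mulVec (fun j => θ j - S⁻¹ j k) j =
      (R.mulVec θ j - (1 : Matrix (Fin p) (Fin p) ℝ) j k) -
        ∑ l ∈ activeT S⁻¹ k, S⁻¹ l k * (R j l - S j l) := by
    rw [e1, ← sum_activeT_mul_inv hS k j, ← Finset.sum_sub_distrib, ← Finset.sum_sub_distrib]
    refine (Finset.sum_coe_sort (activeT S⁻¹ k) fun l => R j l * (θ l - S⁻¹ l k)).trans ?_
    exact Finset.sum_congr rfl fun l _ => by ring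
  rw [e2]
  refine (abs_sub _ _).trans (add_le_add ((hf j).trans ?_) ?_)
  · refine mul_le_mul_of_nonneg_left ?_ hlam.le
    rcases Finset.mem_insert.1 j.2 with h | h
    · rw [h]; exact hwk.trans (le_max_right _ _)
    · exact (hwA j h).trans (le_max_left _ _)
  · rw [← Finset.sum_coe_sort, mul_comm lam]
    refine abs_sum_mul_le hlam.le ?_ fun l => hclose j l
    exact (Finset.sum_coe_sort (activeT S⁻¹ k) fun l => |S⁻¹ l k|).trans_le
      (sum_activeT_abs_inv_le hS k)

/-- The adaptive CLIME is sign consistent whenever `R` is close enough to `S`. -/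
theorem adaptiveClimeConsistent_of_close {n : ℕ} {lamC lamAC : ℝ} (hn : 0 < n)
    (hsup : (support S⁻¹).Nonempty)
    (hC : ∀ k, lamC ≤ min (psiMin S⁻¹ / (4 * matL1 S⁻¹))
      (1 / (4 * matL1 S⁻¹ * (psiMin S⁻¹ + 2 * Gt S k) * (maxDeg S⁻¹ : ℝ)) -
        2 / (matL1 S⁻¹ * (n : ℝ))))
    (hC0 : 0 < lamC) (hAC0 : 0 < lamAC)
    (hA1 : ∀ k, lamAC ≤ psiMin S⁻¹ ^ 2 / (8 * Gt S k))
    (hA2 : ∀ k, (2 * matL1 S⁻¹ * lamC + 1 / (n : ℝ)) *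
      (Ht S k * psiMin S⁻¹ / Gt S k) ≤ lamAC)
    (hA3 : ∀ k, (maxDeg S⁻¹ : ℝ) * lamAC ≤
      min (1 / (2 * Gt S k)) (psiMin S⁻¹ / (4 * Gt S k * (psiMin S⁻¹ + Gt S k))))
    (hclose : ∀ i j, |R i j - S i j| ≤ lamAC)
    (hclose2 : ∀ i j, |R i j - S i j| ≤ lamC / matL1 S⁻¹) :
    AdaptiveClimeConsistent n R S⁻¹ lamC lamAC := by
  classical
  obtain ⟨k₀⟩ : Nonempty (Fin p) := ⟨hsup.some.1⟩
  have hn' : (0 : ℝ) < n := by exact_mod_cast hn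
  have hψ := psiMin_pos hsup
  have hM1 := one_le_matL1_inv hS hdiag k₀
  have hM : 0 < matL1 S⁻¹ := by linarith
  have hd : (1 : ℝ) ≤ maxDeg S⁻¹ := by exact_mod_cast one_le_maxDeg hsup
  set ψ := psiMin S⁻¹ with hψd
  set M := matL1 S⁻¹ with hMd
  set d : ℝ := (maxDeg S⁻¹ : ℝ) with hdd
  have hG : ∀ k, 1 ≤ Gt S k := one_le_Gt hS hdiag
  have hcard : ∀ k, ((active S⁻¹ k).card : ℝ) ≤ d := fun k =>
    Nat.cast_le.2 (card_active_le S⁻¹ k)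
  set ν := 2 * M * lamC + 1 / (n : ℝ) with hν
  have hν0 : 0 < ν := by positivity
  -- Multiplied by `2 M`, the subtracted term `2 / (M n)` becomes `4 / n`; it pays for the `1 / n`
  -- in `ν` and leaves the strict inequality.
  have hνlt : ∀ k, ν * (2 * (ψ + 2 * Gt S k) * d) < 1 := by
    intro k
    have h1 := (hC k).trans (min_le_right _ _)
    have hGk := hG k
    have hD : 0 < 2 * (ψ + 2 * Gt S k) * d :=
      mul_pos (mul_pos two_pos (by linarith)) (by linarith)
    have h2 := mul_le_mul_of_nonneg_left h1 (show 0 ≤ 2 * M by linarith)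
    have e : 2 * M * (1 / (4 * M * (ψ + 2 * Gt S k) * d) - 2 / (M * (n : ℝ))) =
        1 / (2 * (ψ + 2 * Gt S k) * d) - 4 * (1 / (n : ℝ)) := by
      have : ψ + 2 * Gt S k ≠ 0 := by linarith
      have : d ≠ 0 := by linarith
      field_simp
      ring
    rw [e] at h2
    have h3 : 0 < 1 / (n : ℝ) := by positivity
    rw [← lt_div_iff₀ hD]
    linarith
  have hν4 : ν < 1 / 4 := by
    have h1 := hνlt k₀
    have h2 : 4 ≤ 2 * (ψ + 2 * Gt S k₀) * d := by nlinarith [hG k₀]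
    nlinarith
  have hpar : ∀ k, (active S⁻¹ k).Nonempty → Parameters ψ (Gt S k) d lamAC := by
    intro k hk
    have hGk := hG k
    refine ⟨hψ, psiMin_le_Gt hS hk, hGk, hd, hAC0, ?_, ?_⟩
    · have h1 := hA1 k
      rw [le_div_iff₀ (by linarith)] at h1
      linarith
    · have h1 := (hA3 k).trans (min_le_right _ _)
      rw [le_div_iff₀ (mul_pos (by linarith) (by linarith))] at h1
      linarith
  have hAC1 : lamAC ≤ 1 := by
    have hGk := hG k₀
    have h1 := (hA3 k₀).trans (min_le_left _ _)
    rw [le_div_iff₀ (by linarith)] at h1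
    nlinarith [mul_le_mul_of_nonneg_right hd hAC0.le]
  have hfeasS : ∀ i j, |(R * S⁻¹ - 1) i j| ≤ lamC := inv_feasible hS hM hclose2
  refine ⟨?_, fun U hU => ?_⟩
  · obtain ⟨U, hUf, hUm⟩ := exists_isMinOn_weighted R (Matrix.of fun _ _ => 1)
      (Matrix.of fun _ _ => lamC) (by simp) hfeasS
    have e : ∀ U : Matrix (Fin p) (Fin p) ℝ,
        Matrix.hadamard (Matrix.of fun _ _ => (1 : ℝ)) U = U := by
      intro U; ext i j; simp [Matrix.hadamard]
    simp only [e, Matrix.of_apply] at hUm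
    exact ⟨U, hUf, hUm⟩
  have hUS : ∀ i j, |U i j - S⁻¹ i j| ≤ 2 * M * lamC := hU.abs_sub_le hS hM hclose2
  have hn1 : 0 < 1 / (n : ℝ) := by positivity
  set W := adaptiveWeights n U with hW
  have hWapp : ∀ i j, W i j = (|U i j| + 1 / (n : ℝ))⁻¹ := fun i j => rfl
  have hW0 : ∀ i j, 0 < W i j := by
    intro i j
    rw [hWapp]
    have := abs_nonneg (U i j)
    positivity
  have hlow : ∀ i j, |S⁻¹ i j| - 2 * M * lamC ≤ |U i j| := by
    intro i j
    have h1 := abs_sub_abs_le_abs_sub (S⁻¹ i j) (U i j)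
    rw [abs_sub_comm] at h1
    linarith [hUS i j]
  have hwA : ∀ k, ∀ j ∈ active S⁻¹ k, W j k ≤ 2 / ψ := by
    intro k j hj
    obtain ⟨hjk, h0⟩ := mem_active.1 hj
    rw [inv_symm hS] at h0
    have h1 : ψ ≤ |S⁻¹ j k| := psiMin_le hjk h0
    have h2 := (hC k).trans (min_le_left _ _)
    rw [le_div_iff₀ (by linarith)] at h2
    have h3 := hlow j k
    rw [hWapp, show 2 / ψ = (ψ / 2)⁻¹ from (inv_div _ _).symm]
    exact inv_anti₀ (by linarith) (by linarith)
  have hwk : ∀ k, W k k ≤ 4 / 3 := by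
    intro k
    have h1 := one_le_inv_diag hS hdiag k
    have h2 := hlow k k
    have h3 := le_abs_self (S⁻¹ k k)
    rw [hWapp, show (4 / 3 : ℝ) = (3 / 4)⁻¹ from (inv_div _ _).symm]
    exact inv_anti₀ (by norm_num) (by linarith)
  have hwi : ∀ k, ∀ i ∉ activeT S⁻¹ k, 1 / ν ≤ W i k := by
    intro k i hi
    have h1 := hUS i k
    rw [inv_eq_zero_of_notMem_activeT hS hi, sub_zero] at h1
    have h2 := abs_nonneg (U i k)
    rw [hWapp, one_div]
    exact inv_anti₀ (by linarith) (by linarith)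
  -- Stated for all `i`, with a junk value on the active set, so that `choose` returns a total
  -- function.
  have hcoef : ∀ k i, ∃ c : Fin p → ℝ, i ∉ activeT S⁻¹ k →
      (∀ j ∈ activeT S⁻¹ k, ∑ l ∈ activeT S⁻¹ k, R j l * c l = R i j) ∧
      |c k| + lamAC * ∑ j ∈ activeT S⁻¹ k, |c j| * W j k < lamAC * W i k := by
    intro k i
    by_cases hi : i ∈ activeT S⁻¹ k
    · exact ⟨0, fun h => absurd hi h⟩
    have hWi := hwi k i hi
    have hGk := hG k
    have h1 : 2 * (ψ + 2 * Gt S k) * d < W i k := by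
      refine lt_of_lt_of_le ?_ hWi
      rw [lt_div_iff₀ hν0, mul_comm]
      exact hνlt k
    have h2 : 4 < W i k := by
      refine lt_of_lt_of_le ?_ hWi
      rw [lt_div_iff₀ hν0]
      linarith
    have h3 : Ht S k * ψ ≤ lamAC * Gt S k * W i k := by
      have h4 := hA2 k
      rw [mul_div_assoc', div_le_iff₀ (by linarith)] at h4
      have h5 : Ht S k * ψ ≤ lamAC * Gt S k * (1 / ν) := by
        rw [mul_one_div, le_div_iff₀ hν0, mul_comm]
        exact h4
      refine h5.trans (mul_le_mul_of_nonneg_left hWi ?_)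
      exact mul_nonneg hAC0.le (by linarith)
    obtain ⟨c, hc⟩ := exists_coefficients hS hdiag hR hRd hclose hi (hpar k) (hcard k)
      (w := fun j => W j k) (fun j => (hW0 j k).le) (hwA k) (hwk k) h2 h1 h3 hAC0 hAC1
    exact ⟨c, fun _ => hc⟩
  choose c hc using hcoef
  have hc1 : ∀ k, ∀ i ∉ activeT S⁻¹ k, ∀ j ∈ activeT S⁻¹ k,
      ∑ l ∈ activeT S⁻¹ k, R j l * c k i l = R i j := fun k i hi => (hc k i hi).1
  have hc2 : ∀ k, ∀ i ∉ activeT S⁻¹ k,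
      |c k i k| + lamAC * ∑ j ∈ activeT S⁻¹ k, |c k i j| * W j k < lamAC * W i k :=
    fun k i hi => (hc k i hi).2
  have hself : ∀ k, k ∈ activeT S⁻¹ k := self_mem_activeT _
  constructor
  · have hsol : ∀ k, ∃ θ : Fin p → ℝ, ∀ i,
        |R.mulVec θ i - (1 : Matrix (Fin p) (Fin p) ℝ) i k| ≤ lamAC * W i k := by
      intro k
      have hη : Gt S k * ((active S⁻¹ k).card * lamAC) ≤ 1 / 8 := by
        rcases (active S⁻¹ k).eq_empty_or_nonempty with h | h
        · rw [h]; simp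
        · exact le_trans (mul_le_mul_of_nonneg_left
            (mul_le_mul_of_nonneg_right (hcard k) hAC0.le) (by linarith [hG k]))
            (hpar k h).mul_le_eighth
      have hP := isPerturbation_subMat hS hdiag hR hRd hclose k hη
      -- A feasible column: solve the constraints on the active block exactly and extend by zero.
      obtain ⟨x, hx⟩ := hP.exists_mulVec_eq (Pi.single ⟨k, hself k⟩ 1)
      refine ⟨fun l => if h : l ∈ activeT S⁻¹ k then x ⟨l, h⟩ else 0, ?_⟩
      refine feasible_of_support hR (hc1 k) (hself k) (hc2 k) (fun i hi => dif_neg hi) ?_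
      intro j hj
      have h1 : R.mulVec (fun l => if h : l ∈ activeT S⁻¹ k then x ⟨l, h⟩ else 0) j =
          (1 : Matrix (Fin p) (Fin p) ℝ) j k := by
        rw [Matrix.mulVec, dotProduct]
        have h2 := congrFun hx ⟨j, hj⟩
        rw [Matrix.mulVec, dotProduct] at h2
        rw [← Finset.sum_subset (Finset.subset_univ (activeT S⁻¹ k)) (fun l _ hl => by
          rw [dif_neg hl, mul_zero]), ← Finset.sum_coe_sort]
        have e : ∀ l : activeT S⁻¹ k,
            (if h : (l : Fin p) ∈ activeT S⁻¹ k then x ⟨l, h⟩ else 0) = x l := fun l => dif_pos l.2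
        simp only [e]
        refine h2.trans ?_
        simp [Matrix.one_apply, Pi.single_apply]
      rw [h1, sub_self, abs_zero]
      exact mul_nonneg hAC0.le (hW0 j k).le
    choose θ hθ using hsol
    obtain ⟨V, hVf, hVm⟩ := exists_isMinOn_weighted R W (Matrix.of fun i j => lamAC * W i j) hW0
      (V := Matrix.of fun i k => θ k i) fun i k => hθ k i
    exact ⟨V, hVf, hVm⟩
  · intro V hV
    have hcol : ∀ k i, |R.mulVec (fun l => V l k) i - (1 : Matrix (Fin p) (Fin p) ℝ) i k| ≤
        lamAC * W i k := fun k i => hV.1 i k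
    have hsuppV : ∀ k, ∀ i ∉ activeT S⁻¹ k, V i k = 0 := by
      intro k
      refine support_of_optimal hR (hc1 k) (hself k) (hc2 k) hAC0 (fun i => (hW0 i k).le)
        (hcol k) fun θ' hθ' => ?_
      exact IsMinOn.column_le (L := Matrix.of fun i j => lamAC * W i j) hV.1 hV.2 k hθ'
    intro i k hik
    constructor
    · intro h0
      have hact : i ∈ active S⁻¹ k := mem_active.2 ⟨hik, by rwa [inv_symm hS]⟩
      refine sign_eq_of_abs_sub_lt (lt_of_lt_of_le ?_ (psiMin_le hik h0))
      exact abs_sub_inv_lt hS hdiag hR hRd hclose (hpar k ⟨i, hact⟩) (hcard k) (hwA k) (hwk k)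
        (hsuppV k) (hcol k) (Finset.mem_insert_of_mem hact)
    · intro h0
      refine hsuppV k i fun hi => ?_
      rcases Finset.mem_insert.1 hi with h | h
      · exact hik h
      · refine (mem_active.1 h).2 ?_
        rwa [inv_symm hS]

end Consistency

/-! ### Concentration of the rank-based correlation matrix -/

section Concentration

open Real

/-- In the union bound over pairs `i < j` this absorbs the factor 2 of the two-sided tail. -/
lemma two_mul_card_lt_le (p : ℕ) :
    2 * ((Finset.univ.filter fun q : Fin p × Fin p => q.1 < q.2).card : ℝ) ≤ (p : ℝ) ^ 2 := by
  have h1 : (Finset.univ.filter fun q : Fin p × Fin p => q.1 < q.2).card =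
      (Finset.univ.filter fun q : Fin p × Fin p => q.2 < q.1).card :=
    Finset.card_equiv (Equiv.prodComm _ _) fun q => by simp
  have hd : Disjoint (Finset.univ.filter fun q : Fin p × Fin p => q.1 < q.2)
      (Finset.univ.filter fun q : Fin p × Fin p => q.2 < q.1) := by
    rw [Finset.disjoint_filter]
    exact fun q _ h h' => lt_asymm h h'
  have h2 := Finset.card_le_univ ((Finset.univ.filter fun q : Fin p × Fin p => q.1 < q.2) ∪
    (Finset.univ.filter fun q : Fin p × Fin p => q.2 < q.1))
  rw [Finset.card_union_of_disjoint hd, ← h1, Fintype.card_prod, Fintype.card_fin] at h2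
  have h3 : 2 * (Finset.univ.filter fun q : Fin p × Fin p => q.1 < q.2).card ≤ p ^ 2 := by
    rw [sq]; omega
  exact_mod_cast h3

variable {p n : ℕ} {S : Matrix (Fin p) (Fin p) ℝ}

lemma abs_apply_le_one (hS : S.PosDef) (hdiag : ∀ j, S j j = 1) (i j : Fin p) : |S i j| ≤ 1 := by
  have h : ∀ b : ℝ, 0 ≤ 1 + b * (2 * S i j) + b ^ 2 := by
    intro b
    have := hS.posSemidef.dotProduct_mulVec_nonneg (Pi.single i 1 + Pi.single j b)
    rw [star_trivial, dotProduct_single_add_single, hdiag, hdiag, symm_apply hS j i] at this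
    linarith
  rw [abs_le]
  constructor
  · linarith [h 1]
  · linarith [h (-1)]

lemma abs_arcsin_le {r : ℝ} (h : |r| ≤ 1) : |2 / π * arcsin (r / 2)| ≤ 1 / 3 := by
  have hpi := Real.pi_pos
  obtain ⟨h1, h2⟩ := abs_le.1 h
  have key : |arcsin (r / 2)| ≤ π / 6 := by
    rw [abs_le]
    constructor
    · rw [Real.le_arcsin_iff_sin_le' ⟨by linarith, by linarith⟩, Real.sin_neg, Real.sin_pi_div_six]
      linarith
    · rw [Real.arcsin_le_iff_le_sin' ⟨by linarith, by linarith⟩, Real.sin_pi_div_six]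
      linarith
  rw [abs_mul, abs_of_pos (by positivity)]
  calc 2 / π * |arcsin (r / 2)| ≤ 2 / π * (π / 6) := by gcongr
    _ = 1 / 3 := by field_simp; norm_num

lemma abs_sin_sub_sin_le (x y : ℝ) : |sin x - sin y| ≤ |x - y| := by
  rw [Real.sin_sub_sin, abs_mul, abs_mul, abs_two]
  have h1 : |sin ((x - y) / 2)| ≤ |(x - y) / 2| := Real.abs_sin_le_abs
  have h2 : |cos ((x + y) / 2)| ≤ 1 := Real.abs_cos_le_one _
  rw [abs_div, abs_two] at h1
  calc 2 * |sin ((x - y) / 2)| * |cos ((x + y) / 2)| ≤ 2 * (|x - y| / 2) * 1 := by gcongr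
    _ = |x - y| := by ring

/-- The error of the adjusted Spearman correlation is controlled by the U-statistic. -/
lemma abs_rankCorr_sub_le {x : Fin n → Fin p → ℝ} (hn : 3 ≤ n)
    (hx : ∀ j, Function.Injective fun t => x t j) {i j : Fin p} (hS : |S i j| ≤ 1) :
    |rankCorr x i j - S i j| ≤ π * |signU (fun t => x t i) (fun t => x t j) -
      2 / π * arcsin (S i j / 2)| + 2 * π / n := by
  have hpi := Real.pi_pos
  have h := abs_spearman_sub_le hn (hx i) (hx j) (abs_arcsin_le hS)
  obtain ⟨h1, h2⟩ := abs_le.1 hS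
  set θ := 2 / π * arcsin (S i j / 2) with hθ
  have hs : S i j = 2 * sin (π / 6 * (3 * θ)) := by
    rw [hθ, show π / 6 * (3 * (2 / π * arcsin (S i j / 2))) = arcsin (S i j / 2) by field_simp; ring,
      Real.sin_arcsin (by linarith) (by linarith)]
    ring
  have hr : rankCorr x i j =
    2 * sin (π / 6 * spearman (fun t => x t i) (fun t => x t j)) := rfl
  rw [hr]
  nth_rewrite 1 [hs]
  rw [← mul_sub, abs_mul, abs_two]
  have h3 := abs_sin_sub_sin_le (π / 6 * spearman (fun t => x t i) (fun t => x t j))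
    (π / 6 * (3 * θ))
  rw [← mul_sub, abs_mul, abs_of_pos (show 0 < π / 6 by positivity)] at h3
  calc _ ≤ 2 * (π / 6 * (3 * |signU (fun t => x t i) (fun t => x t j) - θ| + 6 / n)) := by
        have := mul_le_mul_of_nonneg_left h (show 0 ≤ π / 6 by positivity)
        linarith
    _ = _ := by ring

variable {Ω : Type*} {mΩ : MeasurableSpace Ω} {μ : Measure Ω} 

lemma measure_signU_le [IsProbabilityMeasure μ] (hS : S.PosDef) (hdiag : ∀ j, S j j = 1)
    {Z : Fin n → Ω → EuclideanSpace ℝ (Fin p)} (hZ : iIndepFun Z μ)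
    (hlaw : ∀ t, HasLaw (Z t) (multivariateGaussian 0 S) μ) (hn : 8 ≤ n) (i j : Fin p) {s : ℝ}
    (hs : 0 ≤ s) :
    μ.real {ω | s ≤ |signU (fun t => Z t ω i) (fun t => Z t ω j) -
      2 / π * arcsin (S i j / 2)|} ≤ 2 * rexp (-(n * s ^ 2) / 8) := by
  obtain ⟨h1, h2⟩ := abs_le.1 (abs_apply_le_one hS hdiag i j)
  let h : EuclideanSpace ℝ (Fin p) × EuclideanSpace ℝ (Fin p) × EuclideanSpace ℝ (Fin p) → ℝ :=
    fun x => Real.sign (x.1 i - x.2.1 i) * Real.sign (x.1 j - x.2.2 j)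
  have hh : Measurable h :=
    (measurable_sign.comp (by fun_prop)).mul (measurable_sign.comp (by fun_prop))
  have hb : ∀ x, |h x| ≤ 1 := fun x => by
    simp only [h, abs_mul]
    exact mul_le_one₀ (abs_sign_le_one _) (abs_nonneg _) (abs_sign_le_one _)
  have hsub := hasSubgaussianMGF_uStatistic (m := n / 3) (n := n) (by omega) (by omega) hZ
    (fun t => (hlaw t).aemeasurable) hh hb (θ := 2 / π * arcsin (S i j / 2)) ?_
  swap
  · intro q hq
    obtain ⟨q1, q2, q3⟩ := mem_distinctTriples.1 hq
    have hi := hZ.precomp (injective_vec_three q1 q2 q3)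
    exact integral_sign_gaussian_differences (Z := fun k => Z (![q.1, q.2.1, q.2.2] k))
      hS.posSemidef hdiag hi (fun t => hlaw _) i j (by linarith) (by linarith)
  -- The number of disjoint triples is a rounded-down quotient, at least `n / 4` for these `n`.
  have hm : (n : ℝ) / 4 ≤ ((n / 3 : ℕ) : ℝ) := by
    have : n ≤ 4 * (n / 3) := by omega
    have : (n : ℝ) ≤ 4 * ((n / 3 : ℕ) : ℝ) := by exact_mod_cast this
    linarith
  have hm0 : (0 : ℝ) < ((n / 3 : ℕ) : ℝ) := by
    have : 0 < n / 3 := by omega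
    exact_mod_cast this
  have hexp : rexp (-s ^ 2 / (2 * (((n / 3 : ℕ) : NNReal)⁻¹ : NNReal))) ≤
      rexp (-(n * s ^ 2) / 8) := by
    rw [Real.exp_le_exp, NNReal.coe_inv, NNReal.coe_natCast]
    have : -s ^ 2 / (2 * ((n / 3 : ℕ) : ℝ)⁻¹) = -(((n / 3 : ℕ) : ℝ) * s ^ 2) / 2 := by
      field_simp
    rw [this]
    have := mul_le_mul_of_nonneg_right hm (sq_nonneg s)
    linarith
  have u1 := (hsub.measure_ge_le hs).trans hexp
  have u2 := (hsub.neg.measure_ge_le hs).trans hexp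
  refine le_trans (le_trans (measureReal_mono ?_) (measureReal_union_le _ _))
    (le_trans (add_le_add u1 u2) (by linarith))
  intro ω hω
  rw [Set.mem_ofPred_eq, le_abs] at hω
  exact hω

lemma ae_gaussian_injective (hS : S.PosDef) (hdiag : ∀ j, S j j = 1)
    {Z : Fin n → Ω → EuclideanSpace ℝ (Fin p)} (hZ : iIndepFun Z μ)
    (hlaw : ∀ t, HasLaw (Z t) (multivariateGaussian 0 S) μ) (hn : 3 ≤ n) :
    ∀ᵐ ω ∂μ, ∀ j, Function.Injective fun t => Z t ω j := by
  rw [ae_all_iff]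
  intro j
  have h : ∀ t s : Fin n, ∀ᵐ ω ∂μ, t ≠ s → Z t ω j ≠ Z s ω j := by
    intro t s
    by_cases hts : t = s
    · exact ae_of_all _ fun ω h => absurd hts h
    -- A third sample index is needed only to fit the three-vector lemma.
    have : ∃ u : Fin n, u ∉ ({t, s} : Finset (Fin n)) := by
      by_contra! hu
      have h1 : (Finset.univ : Finset (Fin n)) ⊆ {t, s} := fun u _ => hu u
      have h2 := (Finset.card_le_card h1).trans Finset.card_le_two
      rw [Finset.card_univ, Fintype.card_fin] at h2
      omega
    obtain ⟨u, hu⟩ := this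
    simp only [Finset.mem_insert, Finset.mem_singleton, not_or] at hu
    have hi := hZ.precomp (injective_vec_three hts (Ne.symm hu.1) (Ne.symm hu.2))
    filter_upwards [gaussian_differences_ne_zero (Z := fun k => Z (![t, s, u] k))
      hS.posSemidef hdiag hi (fun t => hlaw _) j] with ω hω _
    exact hω
  filter_upwards [ae_all_iff.2 fun t => ae_all_iff.2 (h t)] with ω hω t s hts
  by_contra hne
  exact hω t s hne hts

/-- In the nonparanormal model the signs of differences of observations are almost surely those
of Gaussian vectors. -/
lemma IsNonparanormal.exists_gaussian {P : Measure (Fin p → ℝ)} (hP : IsNonparanormal P S)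
    (hS : S.PosDef) (hdiag : ∀ j, S j j = 1) {X : Fin n → Ω → Fin p → ℝ}
    (hX : ∀ t, HasLaw (X t) P μ) (hind : iIndepFun X μ) (hn : 3 ≤ n) :
    ∃ Z : Fin n → Ω → EuclideanSpace ℝ (Fin p), iIndepFun Z μ ∧
      (∀ t, HasLaw (Z t) (multivariateGaussian 0 S) μ) ∧
      ∀ᵐ ω ∂μ, (∀ j, Function.Injective fun t => X t ω j) ∧
        ∀ i j, signU (fun t => X t ω i) (fun t => X t ω j) =
          signU (fun t => Z t ω i) (fun t => Z t ω j) := by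
  obtain ⟨f, D, hf, hmono, hD, hlaw⟩ := hP
  let g : (Fin p → ℝ) → EuclideanSpace ℝ (Fin p) := fun x => WithLp.toLp 2 fun j => f j (x j)
  have hg : Measurable g := by
    have : Measurable fun x : Fin p → ℝ => fun j => f j (x j) :=
      measurable_pi_lambda _ fun j => (hf j).comp (measurable_pi_apply j)
    exact (MeasurableEquiv.toLp 2 (Fin p → ℝ)).measurable.comp this
  have hZ : iIndepFun (fun t => g ∘ X t) μ := hind.comp (fun _ => g) fun _ => hg
  have hZl : ∀ t, HasLaw (g ∘ X t) (multivariateGaussian 0 S) μ := fun t => hlaw.comp (hX t)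
  refine ⟨fun t => g ∘ X t, hZ, hZl, ?_⟩
  have hmem : ∀ᵐ ω ∂μ, ∀ t j, X t ω j ∈ D j := by
    rw [ae_all_iff]
    intro t
    rw [ae_all_iff]
    intro j
    have := hD j
    rw [← (hX t).map_eq] at this
    exact ae_of_ae_map (hX t).aemeasurable this
  filter_upwards [hmem, ae_gaussian_injective hS hdiag hZ hZl hn] with ω h1 h2
  have hsign : ∀ j t s, Real.sign (X t ω j - X s ω j) =
      Real.sign (f j (X t ω j) - f j (X s ω j)) := by
    intro j t s
    -- The transformed values are almost surely distinct, so a merely monotone `f j` is strictly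
    -- increasing on the observed data.
    have hlt : ∀ t s, X t ω j < X s ω j → f j (X t ω j) < f j (X s ω j) := by
      intro t s hts
      refine lt_of_le_of_ne (hmono j (h1 t j) (h1 s j) hts.le) fun he => ?_
      have := h2 j he
      exact hts.ne (by rw [this])
    rcases lt_trichotomy (X t ω j) (X s ω j) with h | h | h
    · rw [Real.sign_of_neg (sub_neg.2 h), Real.sign_of_neg (sub_neg.2 (hlt t s h))]
    · rw [h, sub_self, sub_self]
    · rw [Real.sign_of_pos (sub_pos.2 h), Real.sign_of_pos (sub_pos.2 (hlt s t h))]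
  refine ⟨fun j t s hts => h2 j ?_, fun i j => ?_⟩
  · exact congrArg (f j) hts
  · simp only [signU, hsign]
    rfl

/-- With high probability the rank-based correlation matrix is close to the true one. -/
lemma exists_bad_event [IsProbabilityMeasure μ] {P : Measure (Fin p → ℝ)} (hP : IsNonparanormal P S)
    (hS : S.PosDef) (hdiag : ∀ j, S j j = 1) {X : Fin n → Ω → Fin p → ℝ}
    (hX : ∀ t, HasLaw (X t) P μ) (hind : iIndepFun X μ) (hn : 8 ≤ n) {ε : ℝ}
    (hε : 12 * π / n ≤ ε) :
    ∃ B : Set Ω, μ.real B ≤ (p : ℝ) ^ 2 * rexp (-(1 / 200) * n * ε ^ 2) ∧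
      ∀ ω ∉ B, (∀ i, rankCorr (fun t => X t ω) i i = 1) ∧
        ∀ i j, |rankCorr (fun t => X t ω) i j - S i j| ≤ ε := by
  have hpi := Real.pi_pos
  have hn0 : (0 : ℝ) < n := by
    have : 0 < n := by omega
    exact_mod_cast this
  have hε0 : 0 < ε := lt_of_lt_of_le (by positivity) hε
  obtain ⟨Z, hZ, hZl, hae⟩ := hP.exists_gaussian hS hdiag hX hind (by omega)
  -- The budget `ε` splits as `π s = 5/6 ε` for the U-statistic and `2 π / n ≤ ε / 6` for the bias.
  set s := 5 * ε / (6 * π) with hs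
  let A : Set Ω := {ω | ¬ ((∀ j, Function.Injective fun t => X t ω j) ∧
        ∀ i j, signU (fun t => X t ω i) (fun t => X t ω j) =
          signU (fun t => Z t ω i) (fun t => Z t ω j))}
  let C : Fin p × Fin p → Set Ω := fun q => {ω | s ≤ |signU (fun t => Z t ω q.1)
    (fun t => Z t ω q.2) - 2 / π * arcsin (S q.1 q.2 / 2)|}
  let I := Finset.univ.filter fun q : Fin p × Fin p => q.1 < q.2
  have hA : μ.real A = 0 := by
    rw [measureReal_def, show μ A = 0 from hae, ENNReal.toReal_zero]
  have hC : ∀ q, μ.real (C q) ≤ 2 * rexp (-(1 / 200) * n * ε ^ 2) := by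
    intro q
    refine (measure_signU_le hS hdiag hZ hZl hn q.1 q.2 (by positivity)).trans ?_
    refine mul_le_mul_of_nonneg_left ?_ two_pos.le
    rw [Real.exp_le_exp]
    have h10 : π ^ 2 ≤ 10 := by nlinarith [Real.pi_lt_d2, Real.pi_gt_three]
    -- With the exponent `-n s² / 8` this yields the constant `1 / 200 = 1 / (8 · 25)`.
    have hs2 : ε ^ 2 / 25 ≤ s ^ 2 := by
      rw [hs, div_pow, mul_pow, mul_pow, div_le_div_iff₀ (by norm_num) (by positivity)]
      nlinarith [mul_le_mul_of_nonneg_left h10 (sq_nonneg ε), sq_nonneg ε]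
    have := mul_le_mul_of_nonneg_left hs2 hn0.le
    linarith
  refine ⟨A ∪ ⋃ q ∈ I, C q, ?_, ?_⟩
  · refine (measureReal_union_le _ _).trans ?_
    rw [hA, zero_add]
    refine (measureReal_biUnion_finset_le _ _).trans ?_
    refine (Finset.sum_le_sum fun q _ => hC q).trans ?_
    rw [Finset.sum_const, nsmul_eq_mul, ← mul_assoc, mul_comm _ (2 : ℝ)]
    exact mul_le_mul_of_nonneg_right (two_mul_card_lt_le p) (Real.exp_pos _).le
  · intro ω hω
    simp only [Set.mem_union, Set.mem_iUnion, not_or, not_exists] at hω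
    obtain ⟨h1, h2⟩ := hω
    obtain ⟨hinj, hU⟩ := not_not.1 h1
    have hd : ∀ i, rankCorr (fun t => X t ω) i i = 1 := by
      intro i
      have : spearman (fun t => X t ω i) (fun t => X t ω i) = 1 :=
        spearman_self (by omega) (hinj i)
      simp [rankCorr, this]
    have hlt : ∀ i j, i < j → |rankCorr (fun t => X t ω) i j - S i j| ≤ ε := by
      intro i j hij
      refine (abs_rankCorr_sub_le (by omega) hinj (abs_apply_le_one hS hdiag i j)).trans ?_
      have h3 := h2 (i, j) (Finset.mem_filter.2 ⟨Finset.mem_univ _, hij⟩)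
      simp only [C, Set.mem_ofPred_eq, not_le] at h3
      have h4 := h3.le
      rw [← hU] at h4
      have h5 := mul_le_mul_of_nonneg_left h4 hpi.le
      have h6 : π * s = 5 / 6 * ε := by rw [hs]; field_simp
      have h7 : 2 * π / n = (12 * π / n) / 6 := by ring
      rw [h7]
      linarith
    refine ⟨hd, fun i j => ?_⟩
    rcases lt_trichotomy i j with h | h | h
    · exact hlt i j h
    · rw [h, hd, hdiag, sub_self, abs_zero]
      exact hε0.le
    · have h3 : rankCorr (fun t => X t ω) i j = rankCorr (fun t => X t ω) j i := by
        simp only [rankCorr, Matrix.of_apply]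
        rw [spearman_comm]
      rw [h3, symm_apply hS i j]
      exact hlt j i h

end Concentration

end RankClime

end

/-! ### Assembly of the deterministic and the probabilistic part -/

theorem theorem5 :
    ∃ c₀ : ℝ, 0 < c₀ ∧
      ∀ (p n : ℕ) (S : Matrix (Fin p) (Fin p) ℝ) (P : Measure (Fin p → ℝ))
        (Ω : Type*) [MeasurableSpace Ω] (μ : Measure Ω) [IsProbabilityMeasure μ]
        (X : Fin n → Ω → Fin p → ℝ) (lamC lamAC : ℝ),
        0 < n →
        -- the true covariance matrix is a positive definite correlation matrix
        S.PosDef → (∀ j, S j j = 1) →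
        -- i.i.d. samples from the nonparanormal model
        RankClime.IsNonparanormal P S →
        (∀ t, HasLaw (X t) P μ) → iIndepFun X μ →
        -- the graph has at least one edge
        (RankClime.support S⁻¹).Nonempty →
        -- the range of the first tuning parameter
        (∀ k, lamC ≤ min (RankClime.psiMin S⁻¹ / (4 * RankClime.matL1 S⁻¹))
          (1 / (4 * RankClime.matL1 S⁻¹ * (RankClime.psiMin S⁻¹ + 2 * RankClime.Gt S k) *
              (RankClime.maxDeg S⁻¹ : ℝ))
            - 2 / (RankClime.matL1 S⁻¹ * (n : ℝ)))) →
        12 * Real.pi * RankClime.matL1 S⁻¹ / (n : ℝ) ≤ lamC →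
        -- the range of the second tuning parameter
        (∀ k, lamAC ≤ RankClime.psiMin S⁻¹ ^ 2 / (8 * RankClime.Gt S k)) →
        (∀ k, max (12 * Real.pi / (n : ℝ))
          ((2 * RankClime.matL1 S⁻¹ * lamC + 1 / (n : ℝ)) *
            (RankClime.Ht S k * RankClime.psiMin S⁻¹ / RankClime.Gt S k)) ≤ lamAC) →
        (∀ k, (RankClime.active S⁻¹ k).Nonempty →
          (RankClime.maxDeg S⁻¹ : ℝ) * lamAC ≤ RankClime.lambdaMin
            (RankClime.subMat S (RankClime.active S⁻¹ k) (RankClime.active S⁻¹ k))) →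
        (∀ k, (RankClime.maxDeg S⁻¹ : ℝ) * lamAC ≤
          min (1 / (2 * RankClime.Gt S k))
            (RankClime.psiMin S⁻¹ /
              (4 * RankClime.Gt S k * (RankClime.psiMin S⁻¹ + RankClime.Gt S k)))) →
        1 - (p : ℝ) ^ 2 *
            Real.exp (-c₀ * (n : ℝ) * min (lamAC ^ 2) (1 / RankClime.matL1 S⁻¹ ^ 2 * lamC ^ 2)) ≤
          μ.real {ω | RankClime.AdaptiveClimeConsistent n
            (RankClime.rankCorr fun t => X t ω) S⁻¹ lamC lamAC} := by
  refine ⟨1 / 200, by norm_num, ?_⟩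
  intro p n S P Ω _ μ _ X lamC lamAC hn hS hdiag hP hX hind hsup hC hC0 hA1 hA2 _ hA3
  have hpi := Real.pi_gt_three
  have hn' : (0 : ℝ) < n := by exact_mod_cast hn
  obtain ⟨⟨i, j⟩, hij, hne⟩ := id hsup
  have hM1 := RankClime.one_le_matL1_inv hS hdiag i
  have hM : 0 < RankClime.matL1 S⁻¹ := by linarith
  have hψ : RankClime.psiMin S⁻¹ ≤ RankClime.matL1 S⁻¹ :=
    (RankClime.psiMin_le hij hne).trans ((Finset.single_le_sum (f := fun i => |S⁻¹ i j|)
      (fun _ _ => abs_nonneg _) (Finset.mem_univ i)).trans (RankClime.sum_abs_le_matL1 _ _))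
  have hC0' : 0 < lamC := lt_of_lt_of_le (by positivity) hC0
  have hAC0 : 0 < lamAC :=
    lt_of_lt_of_le (by positivity) ((le_max_left _ _).trans (hA2 i))
  have hC4 : lamC ≤ 1 / 4 := by
    refine ((hC i).trans (min_le_left _ _)).trans ?_
    rw [div_le_div_iff₀ (by linarith) (by norm_num)]
    linarith
  -- The range of `lamC` is nonempty only for large samples, because `12 π M / n ≤ lamC ≤ 1 / 4`.
  have hn8 : 8 ≤ n := by
    have h1 := hC0.trans hC4
    rw [div_le_iff₀ hn'] at h1
    have h2 : 12 * 3 * 1 ≤ 12 * Real.pi * RankClime.matL1 S⁻¹ := by gcongr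
    have h3 : (8 : ℝ) ≤ n := by linarith
    exact_mod_cast h3
  set M := RankClime.matL1 S⁻¹ with hMd
  set ε := min lamAC (lamC / M) with hε
  have hε1 : 12 * Real.pi / n ≤ ε := by
    refine le_min ((le_max_left _ _).trans (hA2 i)) ?_
    rw [le_div_iff₀ hM]
    exact le_of_eq_of_le (by ring) hC0
  obtain ⟨B, hB, hgood⟩ := RankClime.exists_bad_event hP hS hdiag hX hind hn8 hε1
  -- Subadditivity applied to this cover gives the lower bound without any measurability of the
  -- consistency event.
  have hcover : (Set.univ : Set Ω) ⊆ {ω | RankClime.AdaptiveClimeConsistent n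
      (RankClime.rankCorr fun t => X t ω) S⁻¹ lamC lamAC} ∪ B := by
    intro ω _
    by_cases hω : ω ∈ B
    · exact Or.inr hω
    left
    obtain ⟨hd, hcl⟩ := hgood ω hω
    refine RankClime.adaptiveClimeConsistent_of_close hS hdiag (fun i j => ?_) hd hn hsup hC hC0'
      hAC0 hA1 (fun k => (le_max_right _ _).trans (hA2 k)) hA3
      (fun i j => (hcl i j).trans (min_le_left _ _)) fun i j => (hcl i j).trans (min_le_right _ _)
    simp only [RankClime.rankCorr, Matrix.of_apply]
    rw [RankClime.spearman_comm]
  have hmain := (measureReal_mono (μ := μ) hcover).trans (measureReal_union_le _ _)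
  rw [probReal_univ] at hmain
  have hsq : min (lamAC ^ 2) (1 / M ^ 2 * lamC ^ 2) ≤ ε ^ 2 := by
    rcases min_choice lamAC (lamC / M) with h | h
    · rw [hε, h]; exact min_le_left _ _
    · rw [hε, h]; exact (min_le_right _ _).trans_eq (by ring)
  have hexp : (p : ℝ) ^ 2 * Real.exp (-(1 / 200) * n * ε ^ 2) ≤
      (p : ℝ) ^ 2 * Real.exp (-(1 / 200) * n * min (lamAC ^ 2) (1 / M ^ 2 * lamC ^ 2)) := by
    refine mul_le_mul_of_nonneg_left (Real.exp_le_exp.2 ?_) (by positivity)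
    have := mul_le_mul_of_nonneg_left hsq hn'.le
    linarith
  linarith
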